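/- Let \(k(z)=\sum_{n\ge 0}a_nz^n\) be an analytic function without zeros on the unit disc \(\mathbb D\) with \(a_0=1\), \(a_n>0\) for all \(n\), \(0<\inf_n \frac{a_n}{a_{n+1}}\le\sup_n\frac{a_n}{a_{n+1}}<\infty\), and such that \(\lim_{n}\frac{a_n}{a_{n+1}}\) exists; write \(1/k=\sum_n c_nz^n\) near \(0\). For a Hilbert space \(\mathscr E\), let \(H_K(\mathscr E)\) be the \(\mathscr E\)-valued functional Hilbert space on the unit ball \(\mathbb B_d\subset\mathbb C^d\) with reproducing kernel \(K(z,w)1_{\mathscr E}\), \(K(z,w)=k(\langle z,w\rangle)\), with multiplication tuple \(M_z=(M_{z_1},\dots,M_{z_d})\) and row operator \(M_z:H_K(\mathscr E)^d\to H_K(\mathscr E)\). Write \(\gamma_\alpha=|\alpha|!/\alpha!\). Let \(T=(T_1,\dots,T_d)\) be a commuting tuple of bounded operators on a complex Hilbert space \(H\), and let \(\sigma_T(X)=\sum_iT_iXT_i^*\). Suppose that \(T\) is a pure \(K\)-contraction, i.e. \(\frac1K(T)=\mathrm{SOT}\text{-}\sum_{n}c_n\sigma_T^n(1_H)\) exists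 and is positive, and \(\mathrm{SOT}\text{-}\lim_{N\to\infty}\bigl(1_H-\sum_{n=0}^Na_n\sigma_T^n(\tfrac1K(T))\bigr)=0\). Let \(C=\frac1K(T)^{1/2}\), \(\mathscr D=\overline{\operatorname{Im}C}\), and let \(j:H\to H_K(\mathscr D)\), \(jh=\sum_{\alpha}a_{|\alpha|}\gamma_\alpha (CT^{*\alpha}h)z^\alpha\), be the canonical dilation, an isometry. Let \(\Delta\) be the bounded operator on \(H_K(\mathscr D)\) with \(\Delta\sum_\alpha f_\alpha z^\alpha=\sum_\alpha\frac{a_{|\alpha|+1}}{a_{|\alpha|}}f_\alpha z^\alpha\), let \(\Delta_T=j^*\Delta j\), let \(\tilde H\) be the space \(H\) with the scalar product \((x,y)=\langle\Delta_Tx,y\rangle\), and \(I_T:H\to\tilde H\), \(x\mapsto x\) (an invertible bounded operator). Let \(\tilde T:\tilde H^d\to H\) be the row operator with components \(T_iI_T^*\) (a contraction), \(D_{\tilde T}=(1-\tilde T^*\tilde T)^{1/2}\), \(\mathscr D_{\tilde T}=\overline{D_{\tilde T}\tilde H^d}\), and \[\tilde{\mathscr D}=\{y\in\mathscr D_{\tilde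 T}:\ (\oplus jI_T^{-1})D_{\tilde T}y\in M_z^*H_K(\mathscr D)\}\] with the norm of \(\tilde H^d\). For \(z\in\mathbb B_d\), let \(Z:H^d\to H\), \((h_i)\mapsto\sum_iz_ih_i\), let \(ZT^*=\sum_iz_iT_i^*\), and let \(F(ZT^*)=\sum_{n\ge0}a_{n+1}(ZT^*)^n\). Finally, let \(M=(\operatorname{Im}j)^\perp\subset H_K(\mathscr D)\) and \(W(M)=M\ominus\sum_{i=1}^dM_{z_i}M\). Then: (a) \(jT_i^*=M_{z_i}^*j\) for \(i=1,\dots,d\) (so that \(M\) is \(M_z\)-invariant), \(\tilde{\mathscr D}\) is closed in \(\tilde H^d\), and the series \(F(ZT^*)\) is summable in operator norm for each \(z\in\mathbb B_d\). (b) For \(z\in\mathbb B_d\), \(W_T(z)x=-\tilde Tx+CF(ZT^*)Z(\oplus I_T^{-1})D_{\tilde T}x\) defines a bounded operator \(W_T(z)\in L(\tilde{\mathscr D},\mathscr D)\). (c) For each \(x\in\tilde{\mathscr D}\), the function \(W_Tx=W_T(\cdot)x\) belongs to \(H_K(\mathscr D)\) and \(\|W_Tx\|=\|x\|\). (d) \(W(M)=\{W_Tx:\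 x\in\tilde{\mathscr D}\}\). (e) \(W_T\) is a \(K\)-inner function: \(W_T:\mathbb B_d\to L(\tilde{\mathscr D},\mathscr D)\) is analytic, \(\tilde{\mathscr D}\to H_K(\mathscr D)\), \(x\mapsto W_Tx\), is a well-defined linear isometry, and \(W_T(\tilde{\mathscr D})\perp M_z^\alpha W_T(\tilde{\mathscr D})\) for all \(\alpha\in\mathbb N^d\setminus\{0\}\). -/

import Mathlib

open Filter Topology

/-- The coefficient sequence of an admissible function `k(z) = ∑ aₙ zⁿ` on the unit disc. -/
structure KernelSeq where
  a : ℕ → ℝ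
  a_zero : a 0 = 1
  a_pos : ∀ n, 0 < a n
  summable_disc : ∀ z : ℂ, ‖z‖ < 1 → Summable fun n => (a n : ℂ) * z ^ n
  ne_zero_disc : ∀ z : ℂ, ‖z‖ < 1 → ∑' n, (a n : ℂ) * z ^ n ≠ 0
  ratio_inf_pos : 0 < ⨅ n, a n / a (n + 1)
  ratio_bddAbove : BddAbove (Set.range fun n => a n / a (n + 1))
  ratio_tendsto : ∃ r : ℝ, Tendsto (fun n => a n / a (n + 1)) atTop (𝓝 r)

namespace KernelSeq

variable (κ : KernelSeq)

/-- The function `k` on the unit disc. -/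
noncomputable def k (z : ℂ) : ℂ := ∑' n, (κ.a n : ℂ) * z ^ n

/-- The Taylor coefficients `cₙ` at the origin of the reciprocal `1 / k`. -/
noncomputable def c (n : ℕ) : ℂ := iteratedDeriv n (fun z => (κ.k z)⁻¹) 0 / (n.factorial : ℂ)

/-- The weight `a_{|α|} γ_α` with `γ_α = |α|! / α!`. -/
noncomputable def wt {d : ℕ} (α : Fin d → ℕ) : ℝ :=
  κ.a (∑ i, α i) * (Nat.multinomial Finset.univ α : ℝ)

theorem wt_pos {d : ℕ} (α : Fin d → ℕ) : 0 < κ.wt α :=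
  mul_pos (κ.a_pos _) (by exact_mod_cast Nat.multinomial_pos _ _)

theorem ratio_le (n : ℕ) : κ.a n / κ.a (n + 1) ≤ ⨆ m, κ.a m / κ.a (m + 1) :=
  le_ciSup κ.ratio_bddAbove n

theorem ratio_inv_le (n : ℕ) : κ.a (n + 1) / κ.a n ≤ (⨅ m, κ.a m / κ.a (m + 1))⁻¹ := by
  have h : (⨅ m, κ.a m / κ.a (m + 1)) ≤ κ.a n / κ.a (n + 1) :=
    ciInf_le ⟨0, by rintro _ ⟨m, rfl⟩; exact (div_pos (κ.a_pos _) (κ.a_pos _)).le⟩ n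
  rw [← inv_div]
  exact inv_anti₀ κ.ratio_inf_pos h

end KernelSeq

section Degree

variable {d : ℕ}

theorem summable_of_degree {f : (Fin d → ℕ) → ℝ} (hf : ∀ α, 0 ≤ f α)
    (h : Summable fun n => ∑ α ∈ Finset.piAntidiag Finset.univ n, f α) : Summable f := by
  refine summable_of_sum_le hf (c := ∑' n, ∑ α ∈ Finset.piAntidiag Finset.univ n, f α) fun s => ?_
  have hs : s ⊆ (s.image fun α => ∑ i, α i).biUnion
      fun n => Finset.piAntidiag Finset.univ n := by
    intro α hα
    simp only [Finset.mem_biUnion, Finset.mem_image, Finset.mem_piAntidiag]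
    exact ⟨_, ⟨α, hα, rfl⟩, rfl, by simp⟩
  refine (Finset.sum_le_sum_of_subset_of_nonneg hs fun α _ _ => hf α).trans ?_
  rw [Finset.sum_biUnion]
  · exact h.sum_le_tsum _ fun n _ => Finset.sum_nonneg fun α _ => hf α
  · intro m _ n _ hmn
    refine Finset.disjoint_left.2 fun α h1 h2 => hmn ?_
    rw [← (Finset.mem_piAntidiag.1 h1).1, ← (Finset.mem_piAntidiag.1 h2).1]

theorem hasSum_degree {E : Type*} [NormedAddCommGroup E]
    {f : (Fin d → ℕ) → E} {s : E} (h : HasSum f s) :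
    HasSum (fun n => ∑ α ∈ Finset.piAntidiag Finset.univ n, f α) s := by
  classical
  have h1 : HasSum (f ∘ (Equiv.sigmaFiberEquiv fun α : Fin d → ℕ => ∑ i, α i)) s :=
    (Equiv.hasSum_iff _).2 h
  refine h1.sigma fun n => ?_
  have h2 := Finset.hasSum (Finset.piAntidiag (Finset.univ : Finset (Fin d)) n) f
  let e : {α : Fin d → ℕ // ∑ i, α i = n} ≃
      {α // α ∈ Finset.piAntidiag (Finset.univ : Finset (Fin d)) n} :=
    Equiv.subtypeEquivRight fun α => by simp
  exact (Equiv.hasSum_iff e).2 h2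

theorem KernelSeq.summable_wt (κ : KernelSeq) {u : Fin d → ℝ} (hu : ∀ i, 0 ≤ u i)
    (h1 : ∑ i, u i < 1) : Summable fun α : Fin d → ℕ => κ.wt α * ∏ i, u i ^ α i := by
  refine summable_of_degree
    (fun α => mul_nonneg (κ.wt_pos α).le (Finset.prod_nonneg fun i _ => pow_nonneg (hu i) _)) ?_
  have h2 : 0 ≤ ∑ i, u i := Finset.sum_nonneg fun i _ => hu i
  have h3 := (κ.summable_disc ((∑ i, u i : ℝ) : ℂ)
    (by rw [Complex.norm_real, Real.norm_of_nonneg h2]; exact h1))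
  have h4 : Summable fun n => κ.a n * (∑ i, u i) ^ n := by exact_mod_cast h3
  refine h4.congr fun n => ?_
  rw [Finset.sum_pow_eq_sum_piAntidiag, Finset.mul_sum]
  refine Finset.sum_congr rfl fun α hα => ?_
  have : ∑ i, α i = n := by simpa using hα
  rw [KernelSeq.wt, this, mul_assoc]

theorem KernelSeq.hasSum_wt (κ : KernelSeq) {u : Fin d → ℂ} (h1 : ∑ i, ‖u i‖ < 1) :
    HasSum (fun α : Fin d → ℕ => (κ.wt α : ℂ) * ∏ i, u i ^ α i) (κ.k (∑ i, u i)) := by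
  have h2 : Summable (fun α : Fin d → ℕ => (κ.wt α : ℂ) * ∏ i, u i ^ α i) := by
    refine Summable.of_norm ?_
    refine (κ.summable_wt (fun i => norm_nonneg (u i)) h1).congr fun α => ?_
    simp [abs_of_pos (κ.wt_pos α)]
  have h3 := hasSum_degree h2.hasSum
  have h4 : κ.k (∑ i, u i) = ∑' α : Fin d → ℕ, (κ.wt α : ℂ) * ∏ i, u i ^ α i := by
    rw [← h3.tsum_eq]
    refine tsum_congr fun n => ?_
    rw [Finset.sum_pow_eq_sum_piAntidiag, Finset.mul_sum]
    refine Finset.sum_congr rfl fun α hα => ?_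
    have : ∑ i, α i = n := by simpa using hα
    rw [KernelSeq.wt, this]; push_cast; ring
  rw [h4]; exact h2.hasSum

end Degree

/-- Weighted composition on `ℓ²`: `(b_α) ↦ (c_α b_{e α})`. -/
noncomputable def wcomp {ι : Type*} {E : Type*} [NormedAddCommGroup E] [InnerProductSpace ℂ E]
    (e : ι → ι) (he : Function.Injective e) (c : ι → ℝ) (R : ℝ) (hc : ∀ α, |c α| ≤ R) :
    lp (fun _ : ι => E) 2 →L[ℂ] lp (fun _ : ι => E) 2 :=
  have key (b : lp (fun _ : ι => E) 2) : Summable (fun α => ‖(c α : ℂ) • b (e α)‖ ^ 2) ∧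
      ∑' α, ‖(c α : ℂ) • b (e α)‖ ^ 2 ≤ (|R| * ‖b‖) ^ 2 := by
    have h0 : HasSum (fun α => ‖b α‖ ^ 2) (‖b‖ ^ 2) := by
      have := lp.hasSum_norm (p := 2) (by norm_num) b
      simpa using this
    have h1 : Summable (fun α => ‖b (e α)‖ ^ 2) := h0.summable.comp_injective he
    have h2 : ∑' α, ‖b (e α)‖ ^ 2 ≤ ‖b‖ ^ 2 := by
      rw [← h0.tsum_eq]
      exact tsum_comp_le_tsum_of_inj h0.summable (fun _ => by positivity) he
    have h3 (α : ι) : ‖(c α : ℂ) • b (e α)‖ ^ 2 ≤ |R| ^ 2 * ‖b (e α)‖ ^ 2 := by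
      rw [norm_smul, mul_pow, Complex.norm_real, Real.norm_eq_abs]
      exact mul_le_mul_of_nonneg_right
        (pow_le_pow_left₀ (abs_nonneg _) ((hc α).trans (le_abs_self R)) 2) (sq_nonneg _)
    have h4 := Summable.of_nonneg_of_le (fun _ => by positivity) h3 (h1.mul_left _)
    refine ⟨h4, (h4.tsum_le_tsum h3 (h1.mul_left _)).trans ?_⟩
    rw [tsum_mul_left, mul_pow]
    gcongr
  LinearMap.mkContinuous
    { toFun := fun b => ⟨fun α => (c α : ℂ) • b (e α), memℓp_gen (by simpa using (key b).1)⟩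
      map_add' := fun b b' => Subtype.ext (funext fun α => smul_add _ _ _)
      map_smul' := fun t b => Subtype.ext (funext fun α => smul_comm _ _ _) }
    |R| fun b => by
      refine lp.norm_le_of_tsum_le (p := 2) (by norm_num) (by positivity) ?_
      simpa using (key b).2

@[simp]
theorem wcomp_apply {ι : Type*} {E : Type*} [NormedAddCommGroup E] [InnerProductSpace ℂ E]
    (e : ι → ι) (he : Function.Injective e) (c : ι → ℝ) (R : ℝ) (hc : ∀ α, |c α| ≤ R)
    (b : lp (fun _ : ι => E) 2) (α : ι) : wcomp e he c R hc b α = (c α : ℂ) • b (e α) := rfl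

/-- The open Euclidean unit ball of `ℂᵈ`. -/
abbrev UBall (d : ℕ) : Set (EuclideanSpace ℂ (Fin d)) := Metric.ball 0 1

/-- The space `H_K(E)` of all `f = ∑ f_α z^α` with
`‖f‖² = ∑ ‖f_α‖² / (a_{|α|} γ_α) < ∞`. An element is stored through its coordinates
`b_α = f_α / √(a_{|α|} γ_α)`; see `HK.coeff`, the `RKHS` instance (values of `f` on the ball)
and `HK.kernel_eq` (the reproducing kernel is `K(z, w) 1_E`). -/
def HK (_κ : KernelSeq) (d : ℕ) (E : Type*) [NormedAddCommGroup E] : Type _ :=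
  lp (fun _ : Fin d → ℕ => E) 2

namespace HK

variable {κ : KernelSeq} {d : ℕ} {E : Type*} [NormedAddCommGroup E] [InnerProductSpace ℂ E]

noncomputable instance : NormedAddCommGroup (HK κ d E) :=
  inferInstanceAs (NormedAddCommGroup (lp (fun _ : Fin d → ℕ => E) 2))

noncomputable instance : InnerProductSpace ℂ (HK κ d E) :=
  inferInstanceAs (InnerProductSpace ℂ (lp (fun _ : Fin d → ℕ => E) 2))

noncomputable instance [CompleteSpace E] : CompleteSpace (HK κ d E) :=
  inferInstanceAs (CompleteSpace (lp (fun _ : Fin d → ℕ => E) 2))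

/-- The isometric identification with the coordinate sequences. -/
noncomputable def seq : HK κ d E ≃ₗᵢ[ℂ] lp (fun _ : Fin d → ℕ => E) 2 :=
  LinearIsometryEquiv.refl ℂ _

/-- The Taylor coefficient `f_α`. -/
noncomputable def coeff (f : HK κ d E) (α : Fin d → ℕ) : E :=
  ((Real.sqrt (κ.wt α) : ℝ) : ℂ) • (seq f) α

theorem norm_sq_eq_tsum (f : HK κ d E) :
    HasSum (fun α => ‖coeff f α‖ ^ 2 / κ.wt α) (‖f‖ ^ 2) := by
  have h0 : HasSum (fun α => ‖seq f α‖ ^ 2) (‖f‖ ^ 2) := by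
    have := lp.hasSum_norm (p := 2) (by norm_num) (seq f)
    rw [LinearIsometryEquiv.norm_map] at this
    simpa using this
  refine h0.congr_fun ?_
  intro α
  have := κ.wt_pos α
  rw [coeff, norm_smul, Complex.norm_real, mul_pow, Real.norm_eq_abs, sq_abs,
    Real.sq_sqrt this.le]
  field_simp

theorem summable_wt_ball (κ : KernelSeq) (z : UBall d) :
    Summable fun α : Fin d → ℕ => (Real.sqrt (κ.wt α) * ∏ i, ‖z.1 i‖ ^ α i) ^ 2 := by
  have hz : ∑ i, ‖z.1 i‖ ^ 2 < 1 := by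
    rw [← EuclideanSpace.norm_sq_eq]
    have := mem_ball_zero_iff.1 z.2
    nlinarith [norm_nonneg z.1]
  refine (κ.summable_wt (fun i => sq_nonneg ‖z.1 i‖) hz).congr fun α => ?_
  rw [mul_pow, Real.sq_sqrt (κ.wt_pos α).le, ← Finset.prod_pow]
  congr 1
  exact Finset.prod_congr rfl fun i _ => by ring

theorem eval_bound (z : UBall d) (f : HK κ d E) :
    Summable (fun α : Fin d → ℕ => ‖(∏ i, z.1 i ^ α i) • coeff f α‖) ∧
    ∑' α : Fin d → ℕ, ‖(∏ i, z.1 i ^ α i) • coeff f α‖ ≤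
      Real.sqrt (∑' α : Fin d → ℕ, (Real.sqrt (κ.wt α) * ∏ i, ‖z.1 i‖ ^ α i) ^ 2) * ‖f‖ := by
  have h0 : HasSum (fun α => ‖seq f α‖ ^ 2) (‖f‖ ^ 2) := by
    have := lp.hasSum_norm (p := 2) (by norm_num) (seq f)
    rw [LinearIsometryEquiv.norm_map] at this
    simpa using this
  have h1 := summable_wt_ball κ z
  have h2 := Real.summable_and_inner_le_Lp_mul_Lq_tsum_of_nonneg (p := 2) (q := 2)
    (by rw [Real.holderConjugate_iff]; norm_num)
    (f := fun α : Fin d → ℕ => Real.sqrt (κ.wt α) * ∏ i, ‖z.1 i‖ ^ α i)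
    (g := fun α => ‖seq f α‖)
    (fun α => by positivity) (fun α => by positivity) (by simpa using h1) (by simpa using h0.summable)
  have h3 (α : Fin d → ℕ) : ‖(∏ i, z.1 i ^ α i) • coeff f α‖ =
      (Real.sqrt (κ.wt α) * ∏ i, ‖z.1 i‖ ^ α i) * ‖seq f α‖ := by
    rw [coeff, norm_smul, norm_smul, Complex.norm_real, Real.norm_of_nonneg (Real.sqrt_nonneg _)]
    simp only [norm_prod, norm_pow]
    ring
  simp only [h3]
  refine ⟨h2.1, h2.2.trans (le_of_eq ?_)⟩
  simp only [Real.rpow_two, ← Real.sqrt_eq_rpow, h0.tsum_eq, Real.sqrt_sq (norm_nonneg f)]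

theorem coeff_add (f g : HK κ d E) (α : Fin d → ℕ) :
    coeff (f + g) α = coeff f α + coeff g α := by simp [coeff]

theorem coeff_smul (t : ℂ) (f : HK κ d E) (α : Fin d → ℕ) :
    coeff (t • f) α = t • coeff f α := by
  simp only [coeff, map_smul, lp.coeFn_smul, Pi.smul_apply]
  rw [smul_comm]

variable [CompleteSpace E]

/-- Evaluation of `f = ∑ f_α z^α` at a point of the ball. -/
noncomputable def evalCLM (κ : KernelSeq) (E : Type*) [NormedAddCommGroup E]
    [InnerProductSpace ℂ E] [CompleteSpace E] (z : UBall d) : HK κ d E →L[ℂ] E :=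
  LinearMap.mkContinuous
    { toFun := fun f => ∑' α : Fin d → ℕ, (∏ i, z.1 i ^ α i) • coeff f α
      map_add' := fun f g => by
        rw [← (eval_bound z f).1.of_norm.tsum_add (eval_bound z g).1.of_norm]
        exact tsum_congr fun α => by rw [coeff_add, smul_add]
      map_smul' := fun t f => by
        rw [RingHom.id_apply, ← (eval_bound z f).1.of_norm.tsum_const_smul]
        exact tsum_congr fun α => by rw [coeff_smul, smul_comm] }
    (Real.sqrt (∑' α : Fin d → ℕ, (Real.sqrt (κ.wt α) * ∏ i, ‖z.1 i‖ ^ α i) ^ 2))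
    fun f => (norm_tsum_le_tsum_norm (eval_bound z f).1).trans (eval_bound z f).2

theorem hasSum_eval (z : UBall d) (f : HK κ d E) :
    HasSum (fun α : Fin d → ℕ => (∏ i, z.1 i ^ α i) • coeff f α) (evalCLM κ E z f) :=
  (eval_bound z f).1.of_norm.hasSum

theorem coeff_eq_zero_of_hasSum {p : ℕ → ℂ}
    (h : ∀ t : ℂ, ‖t‖ < 1 → HasSum (fun n => t ^ n * p n) 0) : p = 0 := by
  have h1 : HasFPowerSeriesAt (0 : ℂ → ℂ) (FormalMultilinearSeries.ofScalars ℂ p) 0 := by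
    rw [hasFPowerSeriesAt_iff]
    filter_upwards [Metric.ball_mem_nhds (0 : ℂ) one_pos] with t ht
    simpa using h t (mem_ball_zero_iff.1 ht)
  exact (FormalMultilinearSeries.ofScalars_series_eq_zero ℂ).1 h1.eq_zero

theorem mvcoeff_eq_zero {q : (Fin d → ℕ) → ℂ}
    (h : ∀ z : UBall d, HasSum (fun α : Fin d → ℕ => (∏ i, z.1 i ^ α i) * q α) 0) (α : Fin d → ℕ) :
    q α = 0 := by
  classical
  have h1 (z : UBall d) (n : ℕ) :
      ∑ β ∈ Finset.piAntidiag Finset.univ n, (∏ i, z.1 i ^ β i) * q β = 0 := by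
    have h2 := coeff_eq_zero_of_hasSum
      (p := fun n => ∑ β ∈ Finset.piAntidiag Finset.univ n, (∏ i, z.1 i ^ β i) * q β) ?_
    · exact congrFun h2 n
    · intro t ht
      have hz := mem_ball_zero_iff.1 z.2
      have h3 := hasSum_degree (h ⟨t • z.1, by
        rw [mem_ball_zero_iff, norm_smul]; nlinarith [norm_nonneg t, norm_nonneg z.1]⟩)
      refine h3.congr_fun ?_
      intro n
      rw [Finset.mul_sum]
      refine Finset.sum_congr rfl fun β hβ => ?_
      have : ∑ i, β i = n := by simpa using hβ
      simp only [PiLp.smul_apply, smul_eq_mul, mul_pow, Finset.prod_mul_distrib,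
        Finset.prod_pow_eq_pow_sum, this, mul_assoc]
  set n := ∑ i, α i with hn
  let P : MvPolynomial (Fin d) ℂ := ∑ β ∈ Finset.piAntidiag Finset.univ n,
    MvPolynomial.monomial (Finsupp.equivFunOnFinite.symm β) (q β)
  have hP : P = 0 := by
    have hs : (Metric.ball (0 : ℂ) (1 / (d + 1))).Infinite := by
      refine infinite_of_mem_nhds 0 (Metric.ball_mem_nhds _ (by positivity))
    refine MvPolynomial.funext_set (fun _ => Metric.ball (0 : ℂ) (1 / (d + 1))) (fun _ => hs) ?_
    intro x hx
    have hx' : WithLp.toLp 2 x ∈ UBall d := by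
      rw [mem_ball_zero_iff]
      have h4 (i : Fin d) : ‖x i‖ ^ 2 ≤ 1 / (d + 1) := by
        have h5 : ‖x i‖ < 1 / (d + 1) := mem_ball_zero_iff.1 (hx i (Set.mem_univ i))
        have h6 : (1 : ℝ) / (d + 1) ≤ 1 := by
          rw [div_le_one (by positivity)]; linarith [(Nat.cast_nonneg d : (0 : ℝ) ≤ d)]
        nlinarith [norm_nonneg (x i)]
      have h7 : ‖(WithLp.toLp 2 x : EuclideanSpace ℂ (Fin d))‖ ^ 2 < 1 := by
        rw [EuclideanSpace.norm_sq_eq]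
        calc ∑ i, ‖x i‖ ^ 2 ≤ ∑ _i : Fin d, (1 : ℝ) / (d + 1) := Finset.sum_le_sum fun i _ => h4 i
          _ < 1 := by
            rw [Finset.sum_const, Finset.card_univ, Fintype.card_fin, nsmul_eq_mul,
              mul_one_div, div_lt_one (by positivity)]
            linarith
      nlinarith [norm_nonneg (WithLp.toLp 2 x : EuclideanSpace ℂ (Fin d))]
    rw [map_zero, ← h1 ⟨_, hx'⟩ n, map_sum]
    refine Finset.sum_congr rfl fun β _ => ?_
    rw [MvPolynomial.eval_monomial, mul_comm, Finsupp.prod_fintype _ _ (by simp)]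
    rfl
  have := congrArg (MvPolynomial.coeff (Finsupp.equivFunOnFinite.symm α)) hP
  simpa [P, MvPolynomial.coeff_sum, MvPolynomial.coeff_monomial, hn] using this

/-- `H_K(E)` as a Hilbert space of `E`-valued functions on the ball. -/
noncomputable instance : RKHS ℂ (HK κ d E) (UBall d) E where
  coeCLM := ContinuousLinearMap.pi fun z => evalCLM κ E z
  coeCLM_injective := by
    refine (injective_iff_map_eq_zero _).2 fun f hf => ?_
    have h1 (α : Fin d → ℕ) : coeff f α = 0 := by
      refine ext_inner_left ℂ fun v => ?_
      rw [inner_zero_right]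
      refine mvcoeff_eq_zero (q := fun α => inner ℂ v (coeff f α)) (fun z => ?_) α
      have h2 := (hasSum_eval z f).mapL (innerSL ℂ v)
      have h3 : evalCLM κ E z f = 0 := congrFun hf z
      rw [h3] at h2
      simpa [inner_smul_right] using h2
    have h4 : seq f = 0 := by
      ext α
      have h5 := h1 α
      rw [coeff, smul_eq_zero] at h5
      rcases h5 with h5 | h5
      · exact absurd h5 (by exact_mod_cast (Real.sqrt_pos.2 (κ.wt_pos α)).ne')
      · simpa using h5
    exact (LinearIsometryEquiv.map_eq_zero_iff _).1 h4

theorem hasSum_apply (f : HK κ d E) (z : UBall d) :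
    HasSum (fun α : Fin d → ℕ => (∏ i, z.1 i ^ α i) • coeff f α) (f z) :=
  hasSum_eval z f

/-- The function `K(·, w) v`. -/
noncomputable def kvec (κ : KernelSeq) (w : UBall d) (v : E) : HK κ d E :=
  seq.symm ⟨fun α => (((Real.sqrt (κ.wt α) : ℝ) : ℂ) * ∏ i, star (w.1 i) ^ α i) • v,
    memℓp_gen (by
      refine ((summable_wt_ball κ w).mul_right (‖v‖ ^ 2)).congr fun α => ?_
      rw [norm_smul, norm_mul, Complex.norm_real, Real.norm_of_nonneg (Real.sqrt_nonneg _)]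
      simp [mul_pow])⟩

theorem seq_kvec (w : UBall d) (v : E) (α : Fin d → ℕ) :
    seq (kvec κ w v) α =
      (((Real.sqrt (κ.wt α) : ℝ) : ℂ) * ∏ i, star (w.1 i) ^ α i) • v := by
  simp [kvec]

theorem inner_kvec (w : UBall d) (v : E) (f : HK κ d E) :
    inner ℂ (kvec κ w v) f = inner ℂ v (f w) := by
  rw [← LinearIsometryEquiv.inner_map_map seq, lp.inner_eq_tsum]
  have h0 : inner ℂ v (f w) = innerSL ℂ v (f w) := rfl
  rw [h0, ← ((hasSum_apply f w).mapL (innerSL ℂ v)).tsum_eq]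
  refine tsum_congr fun α => ?_
  rw [seq_kvec]
  simp only [innerSL_apply_apply, inner_smul_left, inner_smul_right, coeff, map_mul,
    Complex.conj_ofReal, map_prod, map_pow]
  simp only [Complex.star_def, Complex.conj_conj]
  ring

theorem kerFun_eq (w : UBall d) (v : E) : RKHS.kerFun (HK κ d E) w v = kvec κ w v := by
  refine ext_inner_right ℂ fun f => ?_
  rw [RKHS.kerFun_inner, inner_kvec]

/-- The reproducing kernel of `H_K(E)` is `K(z, w) 1_E` with `K(z, w) = k(⟨z, w⟩)`, where
`⟨z, w⟩ = ∑ zᵢ w̄ᵢ`. -/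
theorem kernel_eq (z w : UBall d) :
    RKHS.kernel (HK κ d E) z w =
      κ.k (∑ i, z.1 i * star (w.1 i)) • ContinuousLinearMap.id ℂ E := by
  ext v
  rw [← RKHS.kerFun_apply, kerFun_eq]
  have hzw : ∑ i, ‖z.1 i * star (w.1 i)‖ < 1 := by
    have h1 : ∑ i, ‖z.1 i‖ ^ 2 < 1 := by
      rw [← EuclideanSpace.norm_sq_eq]
      have := mem_ball_zero_iff.1 z.2
      nlinarith [norm_nonneg z.1]
    have h2 : ∑ i, ‖w.1 i‖ ^ 2 < 1 := by
      rw [← EuclideanSpace.norm_sq_eq]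
      have := mem_ball_zero_iff.1 w.2
      nlinarith [norm_nonneg w.1]
    calc ∑ i, ‖z.1 i * star (w.1 i)‖ ≤ ∑ i, (‖z.1 i‖ ^ 2 + ‖w.1 i‖ ^ 2) / 2 := by
          refine Finset.sum_le_sum fun i _ => ?_
          rw [norm_mul, norm_star]
          nlinarith [sq_nonneg (‖z.1 i‖ - ‖w.1 i‖)]
      _ < 1 := by rw [← Finset.sum_div, Finset.sum_add_distrib]; linarith
  have h3 := (κ.hasSum_wt hzw).smul_const v
  refine (hasSum_apply (kvec κ w v) z).unique (h3.congr_fun fun α => ?_)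
  rw [coeff, seq_kvec, smul_smul, smul_smul]
  congr 1
  have h4 : ((Real.sqrt (κ.wt α) : ℝ) : ℂ) * ((Real.sqrt (κ.wt α) : ℝ) : ℂ) = (κ.wt α : ℂ) := by
    exact_mod_cast Real.mul_self_sqrt (κ.wt_pos α).le
  rw [← h4]
  simp only [mul_pow, Finset.prod_mul_distrib]
  ring

theorem multinomial_le (α : Fin d → ℕ) (i : Fin d) :
    Nat.multinomial Finset.univ α ≤ Nat.multinomial Finset.univ (α + Pi.single i 1) := by
  have h1 := Nat.multinomial_spec Finset.univ α
  have h2 := Nat.multinomial_spec Finset.univ (α + Pi.single i 1)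
  have h3 : ∏ j, ((α + Pi.single i 1 : Fin d → ℕ) j).factorial = (α i + 1) * ∏ j, (α j).factorial := by
    rw [← Finset.mul_prod_erase _ _ (Finset.mem_univ i),
      ← Finset.mul_prod_erase Finset.univ (fun j => (α j).factorial) (Finset.mem_univ i)]
    rw [← mul_assoc]
    congr 1
    · simp [Nat.factorial_succ]
    · refine Finset.prod_congr rfl fun j hj => ?_
      simp [Finset.ne_of_mem_erase hj]
  have h4 : ∑ j, (α + Pi.single i 1 : Fin d → ℕ) j = ∑ j, α j + 1 := by
    simp [Finset.sum_add_distrib]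
  rw [h3, h4, Nat.factorial_succ, ← h1] at h2
  have h5 : 0 < ∏ j, (α j).factorial := Finset.prod_pos fun j _ => Nat.factorial_pos _
  have h6 : (α i + 1) * Nat.multinomial Finset.univ (α + Pi.single i 1) =
      (∑ j, α j + 1) * Nat.multinomial Finset.univ α := by
    apply Nat.eq_of_mul_eq_mul_left h5
    linarith
  have h7 : α i ≤ ∑ j, α j := Finset.single_le_sum (fun _ _ => Nat.zero_le _) (Finset.mem_univ i)
  refine Nat.le_of_mul_le_mul_left ?_ (Nat.succ_pos (α i))
  rw [Nat.succ_eq_add_one, h6]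
  exact Nat.mul_le_mul_right _ (by omega)

theorem shift_bound (κ : KernelSeq) (i : Fin d) (α : Fin d → ℕ) :
    |Real.sqrt (κ.wt α / κ.wt (α + Pi.single i 1))| ≤
      Real.sqrt (⨆ n, κ.a n / κ.a (n + 1)) := by
  rw [abs_of_nonneg (Real.sqrt_nonneg _)]
  refine Real.sqrt_le_sqrt (le_trans ?_ (κ.ratio_le (∑ j, α j)))
  have h4 : ∑ j, (α + Pi.single i 1 : Fin d → ℕ) j = ∑ j, α j + 1 := by
    simp [Finset.sum_add_distrib]
  have h5 : (Nat.multinomial Finset.univ α : ℝ) ≤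
      Nat.multinomial Finset.univ (α + Pi.single i 1) := by exact_mod_cast multinomial_le α i
  have h6 : (0 : ℝ) < Nat.multinomial Finset.univ α := by exact_mod_cast Nat.multinomial_pos _ _
  rw [KernelSeq.wt, KernelSeq.wt, h4, mul_div_mul_comm]
  have h7 := div_pos (κ.a_pos (∑ j, α j)) (κ.a_pos (∑ j, α j + 1))
  exact mul_le_of_le_one_right h7.le ((div_le_one (h6.trans_le h5)).2 h5)

/-- The adjoint of the multiplication by the `i`-th coordinate function: in Taylor coefficients,
`f_α ↦ (ω_α / ω_{α + e_i}) f_{α + e_i}` with `ω_α = a_{|α|} γ_α`. -/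
noncomputable def backShift (κ : KernelSeq) (E : Type*) [NormedAddCommGroup E]
    [InnerProductSpace ℂ E] (i : Fin d) : HK κ d E →L[ℂ] HK κ d E :=
  wcomp (E := E) (fun α : Fin d → ℕ => α + Pi.single i 1) (add_left_injective _)
    (fun α => Real.sqrt (κ.wt α / κ.wt (α + Pi.single i 1))) _ (shift_bound κ i)

/-- The multiplication operator `M_{z_i}` on `H_K(E)`; see `HK.Mz_apply`. -/
noncomputable def Mz (κ : KernelSeq) (E : Type*) [NormedAddCommGroup E]
    [InnerProductSpace ℂ E] [CompleteSpace E] (i : Fin d) : HK κ d E →L[ℂ] HK κ d E :=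
  ContinuousLinearMap.adjoint (backShift κ E i)

theorem backShift_kvec (i : Fin d) (w : UBall d) (v : E) :
    backShift κ E i (kvec κ w v) = star (w.1 i) • kvec κ w v := by
  apply seq.injective
  rw [map_smul]
  ext α
  have h1 : seq (backShift κ E i (kvec κ w v)) α =
      ((Real.sqrt (κ.wt α / κ.wt (α + Pi.single i 1)) : ℝ) : ℂ) •
        seq (kvec κ w v) (α + Pi.single i 1) := rfl
  rw [h1, lp.coeFn_smul, Pi.smul_apply, seq_kvec, seq_kvec, smul_smul, smul_smul]
  congr 1
  have h2 : ((Real.sqrt (κ.wt α / κ.wt (α + Pi.single i 1)) : ℝ) : ℂ) *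
      ((Real.sqrt (κ.wt (α + Pi.single i 1)) : ℝ) : ℂ) = ((Real.sqrt (κ.wt α) : ℝ) : ℂ) := by
    rw [← Complex.ofReal_mul, ← Real.sqrt_mul (div_pos (κ.wt_pos _) (κ.wt_pos _)).le,
      div_mul_cancel₀ _ (κ.wt_pos _).ne']
  rw [← mul_assoc, h2]
  simp only [Pi.add_apply, pow_add, Finset.prod_mul_distrib]
  have h3 : ∏ j, star (w.1 j) ^ (Pi.single i 1 : Fin d → ℕ) j = star (w.1 i) := by
    rw [Finset.prod_eq_single i] <;> simp +contextual
  rw [h3]; ring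

/-- `M_{z_i}` multiplies by the coordinate function. -/
theorem Mz_apply (i : Fin d) (f : HK κ d E) (z : UBall d) :
    (Mz κ E i f) z = z.1 i • f z := by
  refine ext_inner_left ℂ fun v => ?_
  rw [← inner_kvec, Mz, ContinuousLinearMap.adjoint_inner_right, backShift_kvec,
    inner_smul_left, inner_kvec, inner_smul_right]
  simp

/-- The diagonal operator `∑ f_α z^α ↦ ∑ (a_{|α|+1} / a_{|α|}) f_α z^α`. -/
noncomputable def Delta (κ : KernelSeq) (d : ℕ) (E : Type*) [NormedAddCommGroup E]
    [InnerProductSpace ℂ E] : HK κ d E →L[ℂ] HK κ d E :=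
  wcomp (E := E) (fun α : Fin d → ℕ => α) Function.injective_id
    (fun α => κ.a (∑ i, α i + 1) / κ.a (∑ i, α i)) _
    (fun _ => (abs_of_pos (div_pos (κ.a_pos _) (κ.a_pos _))).trans_le (κ.ratio_inv_le _))

theorem seq_Delta (f : HK κ d E) (α : Fin d → ℕ) :
    seq (Delta κ d E f) α =
      ((κ.a (∑ i, α i + 1) / κ.a (∑ i, α i) : ℝ) : ℂ) • seq f α := rfl

theorem coeff_Delta (f : HK κ d E) (α : Fin d → ℕ) :
    coeff (Delta κ d E f) α =
      ((κ.a (∑ i, α i + 1) / κ.a (∑ i, α i) : ℝ) : ℂ) • coeff f α := by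
  rw [coeff, coeff, seq_Delta, smul_comm]

end HK

section Tuples

variable {d : ℕ} {E F : Type*} [NormedAddCommGroup E] [InnerProductSpace ℂ E]
  [NormedAddCommGroup F] [InnerProductSpace ℂ F]

/-- The power `S^α = S₁^{α₁} ⋯ S_d^{α_d}` of a tuple of operators. -/
noncomputable def tuplePow (S : Fin d → E →L[ℂ] E) (α : Fin d → ℕ) : E →L[ℂ] E :=
  (List.ofFn fun i => S i ^ α i).prod

/-- The row operator `E^d → F`, `(x_i) ↦ ∑ S_i x_i`. -/
noncomputable def rowOp (S : Fin d → E →L[ℂ] F) : PiLp 2 (fun _ : Fin d => E) →L[ℂ] F :=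
  ∑ i, S i ∘L PiLp.proj 2 (fun _ : Fin d => E) i

/-- The direct sum `⊕ A : E^d → F^d`. -/
noncomputable def oplus (d : ℕ) (A : E →L[ℂ] F) :
    PiLp 2 (fun _ : Fin d => E) →L[ℂ] PiLp 2 (fun _ : Fin d => F) :=
  (PiLp.continuousLinearEquiv 2 ℂ (fun _ : Fin d => F)).symm.toContinuousLinearMap ∘L
    ContinuousLinearMap.pi fun i => A ∘L PiLp.proj 2 (fun _ : Fin d => E) i

/-- The row operator `Z : H^d → H`, `(h_i) ↦ ∑ z_i h_i`. -/
noncomputable def rowZ (H : Type*) [NormedAddCommGroup H] [InnerProductSpace ℂ H]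
    (z : EuclideanSpace ℂ (Fin d)) : PiLp 2 (fun _ : Fin d => H) →L[ℂ] H :=
  rowOp fun i => z i • ContinuousLinearMap.id ℂ H

@[simp]
theorem rowOp_apply (S : Fin d → E →L[ℂ] F) (x : PiLp 2 (fun _ : Fin d => E)) :
    rowOp S x = ∑ i, S i (x i) := by
  simp [rowOp]

@[simp]
theorem oplus_apply (A : E →L[ℂ] F) (x : PiLp 2 (fun _ : Fin d => E)) (i : Fin d) :
    oplus d A x i = A (x i) := rfl

/-- The defect operator `D_A = (1 - A^* A)^{1/2}` of a contraction `A`. -/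
noncomputable def defectOp [CompleteSpace E] [CompleteSpace F] (A : E →L[ℂ] F) : E →L[ℂ] E :=
  CFC.sqrt (1 - ContinuousLinearMap.adjoint A ∘L A)

/-- The wandering subspace `L ⊖ ∑ S_i L` associated with a tuple `S` on `L`. -/
noncomputable def wanderingSubspace (S : Fin d → E →L[ℂ] E) (L : Submodule ℂ E) :
    Submodule ℂ E :=
  L ⊓ (⨆ i, L.map (S i).toLinearMap)ᗮ

end Tuples

/-- `K`-inner functions: `W` is analytic on the ball, `x ↦ W x` is a well-defined isometry
`E₁ → H_K(E)` and `W E₁ ⟂ M_z^α (W E₁)` for all `α ≠ 0`. Only the values of `W` on the ball matter. -/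
def IsKInner (κ : KernelSeq) {d : ℕ} {E₁ E : Type*} [NormedAddCommGroup E₁]
    [InnerProductSpace ℂ E₁] [NormedAddCommGroup E] [InnerProductSpace ℂ E] [CompleteSpace E]
    (W : EuclideanSpace ℂ (Fin d) → E₁ →L[ℂ] E) : Prop :=
  AnalyticOnNhd ℂ W (UBall d) ∧
    ∃ V : E₁ →ₗᵢ[ℂ] HK κ d E, (∀ (x : E₁) (z : UBall d), V x z = W z x) ∧
      ∀ α : Fin d → ℕ, α ≠ 0 → ∀ x y : E₁, inner ℂ (V x) (tuplePow (HK.Mz κ E) α (V y)) = 0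

section Contractions

variable {d : ℕ} {H : Type*} [NormedAddCommGroup H] [InnerProductSpace ℂ H] [CompleteSpace H]

/-- The map `σ_T(X) = ∑ T_i X T_i^*`. -/
noncomputable def sigmaMap (T : Fin d → H →L[ℂ] H) (X : H →L[ℂ] H) : H →L[ℂ] H :=
  ∑ i, T i ∘L X ∘L ContinuousLinearMap.adjoint (T i)

/-- `P` is the limit of `∑ cₙ σ_Tⁿ(1)` in the strong operator topology. -/
def IsRecipLimit (κ : KernelSeq) (T : Fin d → H →L[ℂ] H) (P : H →L[ℂ] H) : Prop :=
  ∀ h : H, Tendsto (fun N => ∑ n ∈ Finset.range N, κ.c n • ((sigmaMap T)^[n] 1) h) atTop (𝓝 (P h))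

/-- `T` is a `K`-contraction. -/
def IsKContraction (κ : KernelSeq) (T : Fin d → H →L[ℂ] H) : Prop :=
  (∀ i j, Commute (T i) (T j)) ∧ ∃ P : H →L[ℂ] H, P.IsPositive ∧ IsRecipLimit κ T P

open Classical in
/-- The operator `(1/K)(T)` (equal to `0` if the defining series does not converge). -/
noncomputable def recipK (κ : KernelSeq) (T : Fin d → H →L[ℂ] H) : H →L[ℂ] H :=
  if h : ∃ P : H →L[ℂ] H, IsRecipLimit κ T P then h.choose else 0

theorem IsRecipLimit.unique {κ : KernelSeq} {T : Fin d → H →L[ℂ] H} {P Q : H →L[ℂ] H}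
    (hP : IsRecipLimit κ T P) (hQ : IsRecipLimit κ T Q) : P = Q :=
  ContinuousLinearMap.ext fun h => tendsto_nhds_unique (hP h) (hQ h)

theorem recipK_eq {κ : KernelSeq} {T : Fin d → H →L[ℂ] H} {P : H →L[ℂ] H}
    (hP : IsRecipLimit κ T P) : recipK κ T = P := by
  have h : ∃ P : H →L[ℂ] H, IsRecipLimit κ T P := ⟨P, hP⟩
  rw [recipK, dif_pos h]
  exact h.choose_spec.unique hP

/-- Pureness of a `K`-contraction. -/
def IsPure (κ : KernelSeq) (T : Fin d → H →L[ℂ] H) : Prop :=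
  ∀ h : H, Tendsto
    (fun N => h - ∑ n ∈ Finset.range (N + 1), (κ.a n : ℂ) • ((sigmaMap T)^[n] (recipK κ T)) h)
    atTop (𝓝 0)

theorem sigmaMap_iterate (T : Fin d → H →L[ℂ] H) (hT : ∀ i j, Commute (T i) (T j))
    (X : H →L[ℂ] H) (n : ℕ) :
    (sigmaMap T)^[n] X = ∑ α ∈ Finset.piAntidiag Finset.univ n,
      (Nat.multinomial Finset.univ α : ℂ) •
        (tuplePow T α ∘L X ∘L tuplePow (fun i => ContinuousLinearMap.adjoint (T i)) α) := by
  classical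
  let L : Fin d → Module.End ℂ (H →L[ℂ] H) := fun i =>
    { toFun := fun X => T i ∘L X ∘L ContinuousLinearMap.adjoint (T i)
      map_add' := fun X Y => by ext; simp
      map_smul' := fun t X => by ext; simp }
  have hL (i : Fin d) (X : H →L[ℂ] H) :
      L i X = T i * X * ContinuousLinearMap.adjoint (T i) := by
    rw [mul_assoc]; rfl
  have hadj (i j : Fin d) : Commute (ContinuousLinearMap.adjoint (T i))
      (ContinuousLinearMap.adjoint (T j)) := by
    have := (hT i j).star_star
    rwa [ContinuousLinearMap.star_eq_adjoint, ContinuousLinearMap.star_eq_adjoint] at this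
  have hcomm : ∀ a ∈ Set.range L, ∀ b ∈ Set.range L, a * b = b * a := by
    rintro _ ⟨i, rfl⟩ _ ⟨j, rfl⟩
    refine LinearMap.ext fun X => ?_
    rw [Module.End.mul_apply, Module.End.mul_apply, hL, hL, hL, hL]
    have h1 := (hT i j).eq
    have h2 := (hadj i j).eq
    calc T i * (T j * X * ContinuousLinearMap.adjoint (T j)) * ContinuousLinearMap.adjoint (T i)
        = (T i * T j) * X *
          (ContinuousLinearMap.adjoint (T j) * ContinuousLinearMap.adjoint (T i)) := by
          simp only [mul_assoc]
      _ = _ := by rw [h1, ← h2]; simp only [mul_assoc]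
  have hc := Algebra.isMulCommutative_adjoin ℂ hcomm
  let _ : CommRing (Algebra.adjoin ℂ (Set.range L)) :=
    { (inferInstance : Ring (Algebra.adjoin ℂ (Set.range L))) with
      mul_comm := fun a b => hc.is_comm.comm a b }
  let l : Fin d → Algebra.adjoin ℂ (Set.range L) := fun i =>
    ⟨L i, Algebra.subset_adjoin ⟨i, rfl⟩⟩
  have hpow (i : Fin d) (m : ℕ) (X : H →L[ℂ] H) :
      (L i ^ m) X = T i ^ m * X * ContinuousLinearMap.adjoint (T i) ^ m := by
    induction m with
    | zero => simp
    | succ m ih =>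
      rw [pow_succ', Module.End.mul_apply, ih, hL, pow_succ', pow_succ]
      simp only [mul_assoc]
  have hprod (α : Fin d → ℕ) (X : H →L[ℂ] H) :
      ((List.ofFn fun i => L i ^ α i).prod) X =
        tuplePow T α * X * tuplePow (fun i => ContinuousLinearMap.adjoint (T i)) α := by
    have hl (s : List (Fin d)) : (s.map fun i => L i ^ α i).prod X =
        (s.map fun i => T i ^ α i).prod * X *
          (s.map fun i => ContinuousLinearMap.adjoint (T i) ^ α i).prod := by
      induction s with
      | nil => simp
      | cons i s ih =>
        have hc : Commute (ContinuousLinearMap.adjoint (T i) ^ α i)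
            (s.map fun i => ContinuousLinearMap.adjoint (T i) ^ α i).prod := by
          refine Commute.list_prod_right _ _ fun y hy => ?_
          obtain ⟨j, _, rfl⟩ := List.mem_map.1 hy
          exact (hadj i j).pow_pow _ _
        rw [List.map_cons, List.map_cons, List.map_cons, List.prod_cons, List.prod_cons,
          List.prod_cons, Module.End.mul_apply, ih, hpow, hc.eq]
        simp only [mul_assoc]
    rw [tuplePow, tuplePow, List.ofFn_eq_map, List.ofFn_eq_map, List.ofFn_eq_map]
    exact hl _
  have h1 := Finset.sum_pow_eq_sum_piAntidiag (Finset.univ : Finset (Fin d)) l n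
  have h2 := congrArg (fun q => (Algebra.adjoin ℂ (Set.range L)).val q X) h1
  have h3 : (sigmaMap T)^[n] X = ((∑ i, L i) ^ n) X := by
    rw [Module.End.pow_apply]
    congr 1
    funext Y
    rw [LinearMap.sum_apply]; rfl
  rw [h3]
  have h4 : (Algebra.adjoin ℂ (Set.range L)).val ((∑ i, l i) ^ n) = (∑ i, L i) ^ n := by
    rw [map_pow, map_sum]; rfl
  rw [← h4, h2, map_sum, LinearMap.sum_apply]
  refine Finset.sum_congr rfl fun α _ => ?_
  rw [← List.prod_ofFn, map_mul, map_natCast, map_list_prod, List.map_ofFn, Module.End.mul_apply]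
  have h5 : (List.ofFn ((Algebra.adjoin ℂ (Set.range L)).val ∘ fun i => l i ^ α i)) =
      List.ofFn fun i => L i ^ α i := by
    congr 1
  rw [h5, hprod, Module.End.natCast_apply, ← Nat.cast_smul_eq_nsmul ℂ, mul_assoc]
  rfl

end Contractions

theorem adjoint_tuplePow {d : ℕ} {H : Type*} [NormedAddCommGroup H] [InnerProductSpace ℂ H]
    [CompleteSpace H] (T : Fin d → H →L[ℂ] H) (hT : ∀ i j, Commute (T i) (T j))
    (α : Fin d → ℕ) : ContinuousLinearMap.adjoint (tuplePow T α) =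
      tuplePow (fun i => ContinuousLinearMap.adjoint (T i)) α := by
  have hl (s : List (Fin d)) : star ((s.map fun i => T i ^ α i).prod) =
      (s.map fun i => star (T i) ^ α i).prod := by
    induction s with
    | nil => simp
    | cons i s ih =>
      have hc : Commute (star (T i) ^ α i) (s.map fun i => star (T i) ^ α i).prod := by
        refine Commute.list_prod_right _ _ fun y hy => ?_
        obtain ⟨j, _, rfl⟩ := List.mem_map.1 hy
        exact ((hT i j).star_star).pow_pow _ _
      rw [List.map_cons, List.map_cons, List.prod_cons, List.prod_cons, star_mul, ih, star_pow,
        hc.eq]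
  rw [tuplePow, tuplePow, List.ofFn_eq_map, List.ofFn_eq_map]
  exact hl _

/-- A pure `K`-contraction on `H`. -/
structure PureKContraction (κ : KernelSeq) (d : ℕ) (H : Type*) [NormedAddCommGroup H]
    [InnerProductSpace ℂ H] [CompleteSpace H] where
  T : Fin d → H →L[ℂ] H
  isKContraction : IsKContraction κ T
  isPure : IsPure κ T

namespace PureKContraction

variable {κ : KernelSeq} {d : ℕ} {H : Type*} [NormedAddCommGroup H] [InnerProductSpace ℂ H]
  [CompleteSpace H] (S : PureKContraction κ d H)

/-- The defect operator `C = (1/K)(T)^{1/2}`. -/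
noncomputable def C : H →L[ℂ] H := CFC.sqrt (recipK κ S.T)

/-- The defect space, the closure of the range of `C`. -/
noncomputable def defectSpace : Submodule ℂ H := S.C.range.topologicalClosure

noncomputable instance : CompleteSpace S.defectSpace :=
  (Submodule.isClosed_topologicalClosure _).completeSpace_coe

theorem C_mem (h : H) : S.C h ∈ S.defectSpace :=
  Submodule.le_topologicalClosure _ ⟨h, rfl⟩

/-- `C` as an operator into the defect space. -/
noncomputable def C' : H →L[ℂ] S.defectSpace := S.C.codRestrict S.defectSpace S.C_mem

/-- The operator `T^{*α}`. -/
noncomputable def adjPow (α : Fin d → ℕ) : H →L[ℂ] H :=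
  tuplePow (fun i => ContinuousLinearMap.adjoint (S.T i)) α

theorem C_mul_C : S.C * S.C = recipK κ S.T := by
  obtain ⟨P, hP, hlim⟩ := S.isKContraction.2
  refine CFC.sqrt_mul_sqrt_self _ ?_
  rw [recipK_eq hlim]
  exact (ContinuousLinearMap.nonneg_iff_isPositive P).2 hP

theorem inner_sigma (n : ℕ) (h : H) :
    inner ℂ h ((sigmaMap S.T)^[n] (recipK κ S.T) h) =
      ((∑ α ∈ Finset.piAntidiag Finset.univ n,
        (Nat.multinomial Finset.univ α : ℝ) * ‖S.C (S.adjPow α h)‖ ^ 2 : ℝ) : ℂ) := by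
  have hC : IsSelfAdjoint S.C := IsSelfAdjoint.of_nonneg (CFC.sqrt_nonneg _)
  rw [sigmaMap_iterate _ S.isKContraction.1, sum_apply, inner_sum]
  push_cast
  refine Finset.sum_congr rfl fun α _ => ?_
  change inner ℂ h ((Nat.multinomial Finset.univ α : ℂ) •
    tuplePow S.T α (recipK κ S.T (S.adjPow α h))) = _
  rw [inner_smul_right, ← ContinuousLinearMap.adjoint_inner_left,
    adjoint_tuplePow _ S.isKContraction.1, ← S.C_mul_C]
  congr 1
  change inner ℂ (S.adjPow α h) (S.C (S.C (S.adjPow α h))) = _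
  rw [← ContinuousLinearMap.adjoint_inner_left, ← ContinuousLinearMap.star_eq_adjoint, hC.star_eq,
    inner_self_eq_norm_sq_to_K]
  rfl

theorem hasSum_norm (h : H) :
    HasSum (fun α : Fin d → ℕ => κ.wt α * ‖S.C (S.adjPow α h)‖ ^ 2) (‖h‖ ^ 2) := by
  have h1 : HasSum (fun n => κ.a n * ∑ α ∈ Finset.piAntidiag Finset.univ n,
        (Nat.multinomial Finset.univ α : ℝ) * ‖S.C (S.adjPow α h)‖ ^ 2) (‖h‖ ^ 2) := by
    rw [hasSum_iff_tendsto_nat_of_nonneg (fun n => mul_nonneg (κ.a_pos n).le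
      (Finset.sum_nonneg fun α _ => by positivity)), ← tendsto_add_atTop_iff_nat 1]
    have h2 := ((S.isPure h).const_sub h)
    simp only [sub_sub_cancel, sub_zero] at h2
    have h3 := ((innerSL ℂ h).continuous.tendsto _).comp h2
    have h4 := (Complex.continuous_re.tendsto _).comp h3
    have h5 : (innerSL ℂ h h).re = ‖h‖ ^ 2 := by
      rw [innerSL_apply_apply, inner_self_eq_norm_sq_to_K]
      norm_cast
    rw [h5] at h4
    refine h4.congr fun N => ?_
    simp only [Function.comp_apply, map_sum, map_smul, innerSL_apply_apply, S.inner_sigma,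
      smul_eq_mul, Complex.re_sum]
    refine Finset.sum_congr rfl fun n _ => ?_
    rw [← Complex.ofReal_mul, Complex.ofReal_re]
  have h6 : Summable (fun α : Fin d → ℕ => κ.wt α * ‖S.C (S.adjPow α h)‖ ^ 2) := by
    refine summable_of_degree (fun α => mul_nonneg (κ.wt_pos α).le (by positivity))
      (h1.summable.congr fun n => ?_)
    rw [Finset.mul_sum]
    refine Finset.sum_congr rfl fun α hα => ?_
    have : ∑ i, α i = n := by simpa using hα
    rw [KernelSeq.wt, this, mul_assoc]
  have h7 := hasSum_degree h6.hasSum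
  have h8 := h7.unique (h1.congr_fun fun n => by
    rw [Finset.mul_sum]
    refine Finset.sum_congr rfl fun α hα => ?_
    have : ∑ i, α i = n := by simpa using hα
    rw [KernelSeq.wt, this, mul_assoc])
  rw [← h8]
  exact h6.hasSum

theorem norm_coord (h : H) (α : Fin d → ℕ) :
    ‖((Real.sqrt (κ.wt α) : ℝ) : ℂ) • S.C' (S.adjPow α h)‖ ^ 2 =
      κ.wt α * ‖S.C (S.adjPow α h)‖ ^ 2 := by
  rw [norm_smul, mul_pow, Complex.norm_real, Real.norm_eq_abs, sq_abs,
    Real.sq_sqrt (κ.wt_pos α).le]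
  rfl

/-- The canonical `K`-dilation `j h = ∑ a_{|α|} γ_α (C T^{*α} h) z^α`; see `coeff_j`. -/
noncomputable def j : H →ₗᵢ[ℂ] HK κ d S.defectSpace where
  toFun h := HK.seq.symm ⟨fun α => ((Real.sqrt (κ.wt α) : ℝ) : ℂ) • S.C' (S.adjPow α h),
    memℓp_gen (by
      simpa only [ENNReal.toReal_ofNat, Real.rpow_two, S.norm_coord] using (S.hasSum_norm h).summable)⟩
  map_add' h h' := by
    rw [← map_add]; congr 1
    exact Subtype.ext (funext fun α => by
      change ((Real.sqrt (κ.wt α) : ℝ) : ℂ) • S.C' (S.adjPow α (h + h')) =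
        ((Real.sqrt (κ.wt α) : ℝ) : ℂ) • S.C' (S.adjPow α h) +
          ((Real.sqrt (κ.wt α) : ℝ) : ℂ) • S.C' (S.adjPow α h')
      rw [map_add, map_add, smul_add])
  map_smul' t h := by
    rw [RingHom.id_apply, ← map_smul]; congr 1
    exact Subtype.ext (funext fun α => by
      change ((Real.sqrt (κ.wt α) : ℝ) : ℂ) • S.C' (S.adjPow α (t • h)) =
        t • ((Real.sqrt (κ.wt α) : ℝ) : ℂ) • S.C' (S.adjPow α h)
      rw [map_smul, map_smul, smul_comm])
  norm_map' h := by
    have h1 := (lp.hasSum_norm (p := 2) (by norm_num)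
      (⟨fun α => ((Real.sqrt (κ.wt α) : ℝ) : ℂ) • S.C' (S.adjPow α h),
        memℓp_gen (by
      simpa only [ENNReal.toReal_ofNat, Real.rpow_two, S.norm_coord] using (S.hasSum_norm h).summable)⟩ :
        lp (fun _ : Fin d → ℕ => S.defectSpace) 2))
    simp only [ENNReal.toReal_ofNat, Real.rpow_two, S.norm_coord] at h1
    have h2 := h1.unique (S.hasSum_norm h)
    rw [sq_eq_sq₀ (norm_nonneg _) (norm_nonneg _)] at h2
    change ‖HK.seq.symm _‖ = _
    rw [LinearIsometryEquiv.norm_map]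
    exact h2

theorem coeff_j (h : H) (α : Fin d → ℕ) :
    HK.coeff (S.j h) α = (κ.wt α : ℂ) • S.C' (S.adjPow α h) := by
  have h4 : ((Real.sqrt (κ.wt α) : ℝ) : ℂ) * ((Real.sqrt (κ.wt α) : ℝ) : ℂ) = (κ.wt α : ℂ) := by
    exact_mod_cast Real.mul_self_sqrt (κ.wt_pos α).le
  rw [← h4, mul_smul]
  rfl

/-- The subspace `M = H_K(𝒟) ⊖ Im j`. -/
noncomputable def M : Submodule ℂ (HK κ d S.defectSpace) := (S.j.toLinearMap.range)ᗮ

/-- The operator `Δ_T = j^* Δ j`. -/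
noncomputable def DeltaT : H →L[ℂ] H :=
  ContinuousLinearMap.adjoint S.j.toContinuousLinearMap ∘L
    HK.Delta κ d S.defectSpace ∘L S.j.toContinuousLinearMap

theorem inner_Delta {E : Type*} [NormedAddCommGroup E] [InnerProductSpace ℂ E] [CompleteSpace E]
    (f g : HK κ d E) :
    inner ℂ (HK.Delta κ d E f) g = inner ℂ f (HK.Delta κ d E g) := by
  rw [← LinearIsometryEquiv.inner_map_map HK.seq, ← LinearIsometryEquiv.inner_map_map HK.seq f,
    lp.inner_eq_tsum, lp.inner_eq_tsum]
  refine tsum_congr fun α => ?_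
  rw [HK.seq_Delta, HK.seq_Delta, inner_smul_left, inner_smul_right, Complex.conj_ofReal]

theorem Delta_lower {E : Type*} [NormedAddCommGroup E] [InnerProductSpace ℂ E] [CompleteSpace E]
    (f : HK κ d E) :
    (⨆ m, κ.a m / κ.a (m + 1))⁻¹ * ‖f‖ ^ 2 ≤ (inner ℂ (HK.Delta κ d E f) f).re := by
  have h0 : HasSum (fun α => ‖HK.seq f α‖ ^ 2) (‖f‖ ^ 2) := by
    have := lp.hasSum_norm (p := 2) (by norm_num) (HK.seq f)
    rw [LinearIsometryEquiv.norm_map] at this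
    simpa using this
  have h1 : HasSum (fun α => κ.a (∑ i, α i + 1) / κ.a (∑ i, α i) * ‖HK.seq f α‖ ^ 2)
      (inner ℂ (HK.Delta κ d E f) f).re := by
    rw [← LinearIsometryEquiv.inner_map_map HK.seq]
    have h2 := lp.hasSum_inner (𝕜 := ℂ) (HK.seq (HK.Delta κ d E f)) (HK.seq f)
    have h3 := h2.mapL Complex.reCLM
    refine h3.congr_fun fun α => ?_
    rw [HK.seq_Delta, inner_smul_left, Complex.conj_ofReal, inner_self_eq_norm_sq_to_K]
    simp only [Complex.reCLM_apply, Complex.re_ofReal_mul]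
    norm_cast
  refine hasSum_le (fun α => ?_) (h0.mul_left _) h1
  refine mul_le_mul_of_nonneg_right ?_ (sq_nonneg _)
  rw [← inv_div]
  exact inv_anti₀ (div_pos (κ.a_pos _) (κ.a_pos _)) (κ.ratio_le _)

theorem inner_DeltaT (x y : H) :
    inner ℂ (S.DeltaT x) y = inner ℂ (HK.Delta κ d S.defectSpace (S.j x)) (S.j y) := by
  rw [DeltaT, ContinuousLinearMap.comp_apply, ContinuousLinearMap.adjoint_inner_left]
  rfl

theorem DeltaT_lower (x : H) :
    (⨆ m, κ.a m / κ.a (m + 1))⁻¹ * ‖x‖ ^ 2 ≤ (inner ℂ (S.DeltaT x) x).re := by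
  rw [inner_DeltaT, ← S.j.norm_map x]
  exact Delta_lower _

theorem sup_inv_pos (κ : KernelSeq) : 0 < (⨆ m, κ.a m / κ.a (m + 1))⁻¹ :=
  inv_pos.2 ((div_pos (κ.a_pos 0) (κ.a_pos 1)).trans_le (κ.ratio_le 0))

/-- The space `H̃`: the vector space `H` with the scalar product `⟨Δ_T x, y⟩`. -/
def HTilde (_S : PureKContraction κ d H) : Type _ := H

noncomputable instance : AddCommGroup S.HTilde := inferInstanceAs (AddCommGroup H)

noncomputable instance : Module ℂ S.HTilde := inferInstanceAs (Module ℂ H)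

/-- The identity `H → H̃` as a linear map. -/
noncomputable def toTilde : H ≃ₗ[ℂ] S.HTilde := LinearEquiv.refl ℂ H

/-- The scalar product of `H̃`. -/
@[reducible] noncomputable def tildeCore : InnerProductSpace.Core ℂ S.HTilde where
  inner x y := inner ℂ (S.DeltaT (S.toTilde.symm x)) (S.toTilde.symm y)
  conj_inner_symm x y := by
    rw [inner_conj_symm, inner_DeltaT, inner_Delta, DeltaT, ContinuousLinearMap.comp_apply,
      ContinuousLinearMap.adjoint_inner_right]
    rfl
  re_inner_nonneg x := by
    have h := S.DeltaT_lower (S.toTilde.symm x)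
    exact (mul_nonneg (sup_inv_pos κ).le (sq_nonneg _)).trans h
  add_left x y z := by rw [map_add, map_add, inner_add_left]
  smul_left x y t := by rw [map_smul, map_smul, inner_smul_left]
  definite x hx := by
    have h := S.DeltaT_lower (S.toTilde.symm x)
    rw [hx, Complex.zero_re] at h
    have h1 : ‖S.toTilde.symm x‖ ^ 2 ≤ 0 := nonpos_of_mul_nonpos_right h (sup_inv_pos κ)
    have h2 : S.toTilde.symm x = 0 := by
      rw [← norm_eq_zero]; exact pow_eq_zero_iff two_ne_zero |>.1 (le_antisymm h1 (sq_nonneg _))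
    exact (LinearEquiv.map_eq_zero_iff _).1 h2

noncomputable instance : NormedAddCommGroup S.HTilde := S.tildeCore.toNormedAddCommGroup

noncomputable instance : InnerProductSpace ℂ S.HTilde := InnerProductSpace.ofCore S.tildeCore.toCore

theorem tilde_inner (x y : H) :
    inner ℂ (S.toTilde x) (S.toTilde y) = inner ℂ (S.DeltaT x) y := rfl

theorem tilde_norm_sq (x : H) : ‖S.toTilde x‖ ^ 2 = (inner ℂ (S.DeltaT x) x).re := by
  rw [← S.tilde_inner, inner_self_eq_norm_sq_to_K]
  norm_cast

/-- The invertible operator `I_T : H → H̃`, `x ↦ x`. -/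
noncomputable def IT : H ≃L[ℂ] S.HTilde :=
  S.toTilde.toContinuousLinearEquivOfBounds (Real.sqrt ‖S.DeltaT‖)
    (Real.sqrt (⨆ m, κ.a m / κ.a (m + 1)))
    (fun x => by
      refine (sq_le_sq₀ (norm_nonneg _) (by positivity)).1 ?_
      rw [S.tilde_norm_sq, mul_pow, Real.sq_sqrt (norm_nonneg _)]
      refine (Complex.re_le_norm _).trans ((norm_inner_le_norm _ _).trans ?_)
      rw [sq, ← mul_assoc]
      exact mul_le_mul_of_nonneg_right (S.DeltaT.le_opNorm x) (norm_nonneg _))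
    (fun x => by
      have hpos : 0 < ⨆ m, κ.a m / κ.a (m + 1) := inv_pos.1 (sup_inv_pos κ)
      have h := S.DeltaT_lower (S.toTilde.symm x)
      rw [← S.tilde_norm_sq, LinearEquiv.apply_symm_apply, inv_mul_le_iff₀ hpos] at h
      refine (sq_le_sq₀ (norm_nonneg _) (by positivity)).1 ?_
      rwa [mul_pow, Real.sq_sqrt hpos.le])

noncomputable instance : CompleteSpace S.HTilde :=
  (completeSpace_congr (e := S.IT.toEquiv) S.IT.isUniformEmbedding).1 inferInstance

/-- The row operator `T̃ : H̃^d → H` with components `T̃_i = T_i I_T^*`. -/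
noncomputable def rowTilde : PiLp 2 (fun _ : Fin d => S.HTilde) →L[ℂ] H :=
  rowOp fun i => S.T i ∘L ContinuousLinearMap.adjoint (S.IT : H →L[ℂ] S.HTilde)

/-- The defect operator `D_{T̃} = (1 - T̃^* T̃)^{1/2}` on `H̃^d`. -/
noncomputable def defectTilde :
    PiLp 2 (fun _ : Fin d => S.HTilde) →L[ℂ] PiLp 2 (fun _ : Fin d => S.HTilde) :=
  defectOp S.rowTilde

/-- The operator `(⊕ I_T⁻¹) D_{T̃} : H̃^d → H^d`. -/
noncomputable def invDefect :
    PiLp 2 (fun _ : Fin d => S.HTilde) →L[ℂ] PiLp 2 (fun _ : Fin d => H) :=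
  oplus d (S.IT.symm : S.HTilde →L[ℂ] H) ∘L S.defectTilde

/-- The column operator `M_z^* : H_K(𝒟) → H_K(𝒟)^d`. -/
noncomputable def colMzAdj :
    HK κ d S.defectSpace →L[ℂ] PiLp 2 (fun _ : Fin d => HK κ d S.defectSpace) :=
  ContinuousLinearMap.adjoint (rowOp (HK.Mz κ S.defectSpace))

/-- The space `𝒟̃` of all `y` in the closure of the range of `D_{T̃}` with
`(⊕ j I_T⁻¹) D_{T̃} y ∈ M_z^* H_K(𝒟)`, with the norm of `H̃^d`. -/
noncomputable def tildeD : Submodule ℂ (PiLp 2 (fun _ : Fin d => S.HTilde)) :=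
  S.defectTilde.range.topologicalClosure ⊓
    S.colMzAdj.range.comap
      (oplus d S.j.toContinuousLinearMap ∘L S.invDefect).toLinearMap

/-- The operator `Z T^* = ∑ z_i T_i^*`. -/
noncomputable def ZTadj (z : EuclideanSpace ℂ (Fin d)) : H →L[ℂ] H :=
  ∑ i, z i • ContinuousLinearMap.adjoint (S.T i)

/-- The operator `F(Z T^*)` for `F(ζ) = ∑ a_{n+1} ζⁿ`. -/
noncomputable def FT (z : EuclideanSpace ℂ (Fin d)) : H →L[ℂ] H :=
  ∑' n, (κ.a (n + 1) : ℂ) • S.ZTadj z ^ n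

/-- The operator `W_T(z) = -T̃ + C F(Z T^*) Z (⊕ I_T⁻¹) D_{T̃}` on `𝒟̃`, with values in `H`. -/
noncomputable def WT (z : EuclideanSpace ℂ (Fin d)) : S.tildeD →L[ℂ] H :=
  (-S.rowTilde + S.C ∘L S.FT z ∘L rowZ H z ∘L S.invDefect) ∘L S.tildeD.subtypeL

end PureKContraction

/-!
Every `f ∈ H_K(E)` satisfies `f = f(0) + M_z (⊕ Δ) M_z^* f`. Applied to `f = j h`, this gives
`T̃ T̃^* = 1 - C²`, so that `T̃` is a contraction and `D_{T̃^*} = C`.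

A function `f` lies in `W(M)` if and only if `j^* f = 0` and `M_z^* f = (⊕ j I_T⁻¹) x` for some
`x ∈ H̃^d`. The same formula for `f` turns the first condition into `T̃ x = -C f(0)`. Since
`C = D_{T̃^*}`, the Julia operator of `T̃` provides `y` with `x = D_{T̃} y` and `f(0) = -T̃ y`.
Hence `f = -T̃ y + M_z (⊕ Δ j I_T⁻¹) D_{T̃} y = W_T y`, and
`‖f‖² = ‖T̃ y‖² + ‖D_{T̃} y‖² = ‖y‖²`.

The series `F(Z T^*)` converges because `∑ₘ aₘ ⟨σ_Tᵐ((1/K)(T)) h, h⟩ = ‖h‖²`. Replacing `h` by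
`(Z T^*)ⁿ h` shifts `m` to `m + n` at the cost of a factor `‖z‖²ⁿ`, so a comparison of `aₘ` with
`aₘ₊ₙ` bounds `‖(Z T^*)ⁿ‖`.
-/

section DefectOperators

open ContinuousLinearMap

variable {E F : Type*} [NormedAddCommGroup E] [InnerProductSpace ℂ E] [CompleteSpace E]
  [NormedAddCommGroup F] [InnerProductSpace ℂ F] [CompleteSpace F]

theorem comp_eq_zero_of_comp_eq_neg_comp {S : F →L[ℂ] F} {R : E →L[ℂ] E} (hS : 0 ≤ S)
    (hR : 0 ≤ R) {Q : E →L[ℂ] F} (h : S ∘L Q = -(Q ∘L R)) : S ∘L Q = 0 := by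
  have hconj : (adjoint Q ∘L Q) * R = -(adjoint Q ∘L S ∘L Q) := by
    rw [h, comp_neg, neg_neg, mul_def, comp_assoc]
  have hconj_nonneg : 0 ≤ adjoint Q ∘L S ∘L Q :=
    (nonneg_iff_isPositive _).2 (((nonneg_iff_isPositive S).1 hS).adjoint_conj Q)
  have hcomm : Commute (adjoint Q ∘L Q) R := by
    have h1 := congrArg adjoint hconj
    rw [map_neg, (IsSelfAdjoint.of_nonneg hconj_nonneg).adjoint_eq, ← hconj, mul_def,
      adjoint_comp, adjoint_comp, adjoint_adjoint, (IsSelfAdjoint.of_nonneg hR).adjoint_eq] at h1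
    exact h1.symm
  have hconj_eq_zero : (adjoint Q ∘L Q) * R = 0 := by
    refine le_antisymm (hconj ▸ neg_nonpos.2 hconj_nonneg) (hcomm.mul_nonneg ?_ hR)
    exact (nonneg_iff_isPositive _).2 (isPositive_adjoint_comp_self Q)
  have hQR : Q ∘L R = 0 := by
    rw [← adjoint_comp_self_eq_zero_iff, adjoint_comp, comp_assoc, ← comp_assoc _ Q R,
      ← mul_def _ R, hconj_eq_zero, comp_zero]
  rw [h, hQR, neg_zero]

theorem comp_eq_comp_of_mul_self_comp_eq {S : F →L[ℂ] F} {R : E →L[ℂ] E} (hS : 0 ≤ S)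
    (hR : 0 ≤ R) {B : E →L[ℂ] F} (h : (S * S) ∘L B = B ∘L (R * R)) : S ∘L B = B ∘L R := by
  set Q : E →L[ℂ] F := S ∘L B - B ∘L R with hQ
  have hSQ : S ∘L Q = -(Q ∘L R) := by
    rw [hQ, comp_sub, sub_comp, neg_sub, comp_assoc B, ← mul_def R, ← h]
    rfl
  have hSQ0 : S ∘L Q = 0 := comp_eq_zero_of_comp_eq_neg_comp hS hR hSQ
  have hQR0 : Q ∘L R = 0 := by rw [← neg_eq_zero, ← hSQ, hSQ0]
  have hQS0 : adjoint Q ∘L S = 0 := by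
    rw [← (IsSelfAdjoint.of_nonneg hS).adjoint_eq, ← adjoint_comp, hSQ0, map_zero]
  have hRQ0 : R ∘L adjoint Q = 0 := by
    rw [← (IsSelfAdjoint.of_nonneg hR).adjoint_eq, ← adjoint_comp, hQR0, map_zero]
  have hQQ : adjoint Q ∘L Q = -(adjoint Q ∘L B ∘L R) := by
    conv_lhs => rw [hQ, comp_sub, ← comp_assoc _ S B]
    rw [hQS0, zero_comp, zero_sub]
  refine sub_eq_zero.1 (adjoint_comp_self_eq_zero_iff.1 (adjoint_comp_self_eq_zero_iff.1 ?_))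
  rw [adjoint_comp, adjoint_adjoint]
  nth_rw 1 [hQQ]
  rw [neg_comp, comp_assoc, comp_assoc, ← comp_assoc R, hRQ0, zero_comp, comp_zero, comp_zero,
    neg_zero]

theorem adjoint_comp_self_le_one_iff {A : E →L[ℂ] F} : adjoint A ∘L A ≤ 1 ↔ ‖A‖ ≤ 1 := by
  rw [← CStarAlgebra.norm_le_one_iff_of_nonneg _
    ((nonneg_iff_isPositive _).2 (isPositive_adjoint_comp_self A)), norm_adjoint_comp_self,
    ← abs_le_one_iff_mul_self_le_one, abs_norm]

theorem defectOp_nonneg (A : E →L[ℂ] F) : 0 ≤ defectOp A :=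
  CFC.sqrt_nonneg (1 - adjoint A ∘L A)

theorem adjoint_defectOp (A : E →L[ℂ] F) : adjoint (defectOp A) = defectOp A :=
  (IsSelfAdjoint.of_nonneg (defectOp_nonneg A)).adjoint_eq

variable {A : E →L[ℂ] F}

theorem defectOp_mul_self (hA : ‖A‖ ≤ 1) : defectOp A * defectOp A = 1 - adjoint A ∘L A :=
  CFC.sqrt_mul_sqrt_self _ (sub_nonneg.2 (adjoint_comp_self_le_one_iff.2 hA))

theorem defectOp_defectOp_apply (hA : ‖A‖ ≤ 1) (x : E) :
    defectOp A (defectOp A x) = x - adjoint A (A x) :=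
  DFunLike.congr_fun (defectOp_mul_self hA) x

theorem norm_adjoint_le_one (hA : ‖A‖ ≤ 1) : ‖adjoint A‖ ≤ 1 :=
  (LinearIsometryEquiv.norm_map adjoint A).trans_le hA

theorem defectOp_comp_adjoint (hA : ‖A‖ ≤ 1) :
    defectOp A ∘L adjoint A = adjoint A ∘L defectOp (adjoint A) := by
  refine comp_eq_comp_of_mul_self_comp_eq (defectOp_nonneg _) (defectOp_nonneg _) ?_
  rw [defectOp_mul_self hA, defectOp_mul_self (norm_adjoint_le_one hA), adjoint_adjoint, sub_comp,
    comp_sub, one_def, one_def, id_comp, comp_id, comp_assoc]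

theorem defectOp_adjoint_apply (hA : ‖A‖ ≤ 1) (v : F) :
    defectOp A (adjoint A v) = adjoint A (defectOp (adjoint A) v) :=
  DFunLike.congr_fun (defectOp_comp_adjoint hA) v

theorem apply_defectOp (hA : ‖A‖ ≤ 1) (x : E) : A (defectOp A x) = defectOp (adjoint A) (A x) := by
  simpa only [adjoint_adjoint] using (defectOp_adjoint_apply (norm_adjoint_le_one hA) x).symm

theorem norm_apply_sq_add_norm_defectOp_sq (hA : ‖A‖ ≤ 1) (x : E) :
    ‖A x‖ ^ 2 + ‖defectOp A x‖ ^ 2 = ‖x‖ ^ 2 := by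
  have h : inner ℂ (A x) (A x) + inner ℂ (defectOp A x) (defectOp A x) = inner ℂ x x := by
    rw [← adjoint_inner_right, ← adjoint_inner_right (defectOp A), adjoint_defectOp,
      defectOp_defectOp_apply hA, inner_sub_right, add_sub_cancel]
  simp only [inner_self_eq_norm_sq_to_K] at h
  exact_mod_cast h

theorem apply_mem_closure_range_defectOp_adjoint (hA : ‖A‖ ≤ 1) {x : E}
    (hx : x ∈ (defectOp A).range.topologicalClosure) :
    A x ∈ (defectOp (adjoint A)).range.topologicalClosure := by
  refine map_mem_closure A.continuous hx ?_
  rintro _ ⟨y, rfl⟩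
  exact ⟨A y, (apply_defectOp hA y).symm⟩

/-- The solution `y = D_A x + A^* v` is read off from the Julia operator of `A`. -/
theorem exists_defectOp_eq_and_apply_eq (hA : ‖A‖ ≤ 1) {x : E} {v : F}
    (h : A x = defectOp (adjoint A) v)
    (hv : v ∈ (defectOp (adjoint A)).range.topologicalClosure) :
    ∃ y ∈ (defectOp A).range.topologicalClosure, defectOp A y = x ∧ A y = v := by
  have hA' : ‖adjoint A‖ ≤ 1 := norm_adjoint_le_one hA
  refine ⟨defectOp A x + adjoint A v, add_mem ?_ ?_, ?_, ?_⟩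
  · exact Submodule.le_topologicalClosure _ ⟨x, rfl⟩
  · simpa only [adjoint_adjoint] using apply_mem_closure_range_defectOp_adjoint hA' hv
  · rw [map_add, defectOp_defectOp_apply hA, defectOp_adjoint_apply hA, h, sub_add_cancel]
  · rw [map_add, apply_defectOp hA, h, defectOp_defectOp_apply hA', adjoint_adjoint,
      sub_add_cancel]

end DefectOperators

section Tuples

open ContinuousLinearMap (adjoint adjoint_inner_left adjoint_inner_right)

variable {d : ℕ} {E F : Type*} [NormedAddCommGroup E] [InnerProductSpace ℂ E]
  [NormedAddCommGroup F] [InnerProductSpace ℂ F]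

theorem adjoint_rowOp_apply [CompleteSpace E] [CompleteSpace F] (S : Fin d → E →L[ℂ] F) (x : F)
    (i : Fin d) : adjoint (rowOp S) x i = adjoint (S i) x := by
  have h : adjoint (rowOp S) x = WithLp.toLp 2 fun i => adjoint (S i) x := by
    refine ext_inner_right ℂ fun y => ?_
    simp only [adjoint_inner_left, rowOp_apply, PiLp.inner_apply, inner_sum]
  rw [h]

theorem rowOp_comp_oplus_apply {G : Type*} [NormedAddCommGroup G] [InnerProductSpace ℂ G]
    (S : Fin d → F →L[ℂ] G) (A : E →L[ℂ] F) (x : PiLp 2 (fun _ : Fin d => E)) :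
    (rowOp S ∘L oplus d A) x = ∑ i, S i (A (x i)) :=
  rowOp_apply S _

theorem tuplePow_eq_noncommProd {S : Fin d → E →L[ℂ] E} (hS : ∀ i j, Commute (S i) (S j))
    (α : Fin d → ℕ) : tuplePow S α = Finset.univ.noncommProd (fun i => S i ^ α i)
      fun i _ j _ _ => (hS i j).pow_pow _ _ := by
  have h := Finset.noncommProd_toFinset (List.finRange d) (fun i => S i ^ α i)
    (fun i _ j _ _ => (hS i j).pow_pow _ _) (List.nodup_finRange d)
  rw [tuplePow, List.ofFn_eq_map, ← h]
  exact Finset.noncommProd_congr (List.toFinset_finRange d) (fun _ _ => rfl) _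

theorem tuplePow_zero (S : Fin d → E →L[ℂ] E) : tuplePow S 0 = 1 := by
  simp [tuplePow]

theorem tuplePow_add {S : Fin d → E →L[ℂ] E} (hS : ∀ i j, Commute (S i) (S j))
    (α β : Fin d → ℕ) : tuplePow S (α + β) = tuplePow S α * tuplePow S β := by
  simp only [tuplePow_eq_noncommProd hS]
  refine Eq.trans (Finset.noncommProd_congr rfl (fun i _ => pow_add (S i) (α i) (β i)) _) ?_
  exact Finset.noncommProd_mul_distrib _ _ _ _ fun i _ j _ _ => (hS i j).pow_pow _ _

theorem tuplePow_single {S : Fin d → E →L[ℂ] E} (hS : ∀ i j, Commute (S i) (S j)) (i : Fin d) :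
    tuplePow S (Pi.single i 1) = S i := by
  rw [tuplePow_eq_noncommProd hS]
  refine (Finset.mul_noncommProd_erase _ (Finset.mem_univ i) _ _).symm.trans ?_
  have herase := Finset.noncommProd_eq_pow_card (Finset.univ.erase i)
    (fun j => S j ^ (Pi.single i 1 : Fin d → ℕ) j) (fun j _ k _ _ => (hS j k).pow_pow _ _) 1
    fun j hj => by simp [Finset.ne_of_mem_erase hj]
  exact (congrArg _ herase).trans (by simp)

theorem tuplePow_smul (z : Fin d → ℂ) (S : Fin d → E →L[ℂ] E) (α : Fin d → ℕ) :
    tuplePow (fun i => z i • S i) α = (∏ i, z i ^ α i) • tuplePow S α := by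
  simp only [tuplePow, smul_pow]
  exact (MultilinearMap.mkPiAlgebraFin ℂ d (E →L[ℂ] E)).map_smul_univ _ _

theorem sum_smul_pow_eq {S : Fin d → E →L[ℂ] E} (hS : ∀ i j, Commute (S i) (S j))
    (z : Fin d → ℂ) (n : ℕ) :
    (∑ i, z i • S i) ^ n = ∑ α ∈ Finset.piAntidiag Finset.univ n,
      ((Nat.multinomial Finset.univ α : ℂ) * ∏ i, z i ^ α i) • tuplePow S α := by
  have hzS (i j : Fin d) : Commute (z i • S i) (z j • S j) :=
    ((hS i j).smul_left _).smul_right _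
  rw [Finset.sum_pow_eq_sum_piAntidiag_of_commute _ _ fun i _ j _ _ => hzS i j]
  refine Finset.sum_congr rfl fun α _ => ?_
  rw [← tuplePow_eq_noncommProd hzS, tuplePow_smul, mul_smul, ← nsmul_eq_mul,
    Nat.cast_smul_eq_nsmul]

theorem tuplePow_mem {S : Fin d → E →L[ℂ] E} {L : Submodule ℂ E} (hL : ∀ i, ∀ x ∈ L, S i x ∈ L)
    (α : Fin d → ℕ) {x : E} (hx : x ∈ L) : tuplePow S α x ∈ L := by
  let P : Submonoid (E →L[ℂ] E) :=
    { carrier := {A | ∀ x ∈ L, A x ∈ L}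
      one_mem' := fun _ hx => hx
      mul_mem' := fun hA hB x hx => hA _ (hB x hx) }
  have hmem : tuplePow S α ∈ P := P.list_prod_mem fun A hA => by
    obtain ⟨i, rfl⟩ := List.mem_ofFn.1 hA
    exact pow_mem (show S i ∈ P from hL i) _
  exact hmem x hx

theorem single_le_iff {α : Fin d → ℕ} {i : Fin d} : Pi.single i 1 ≤ α ↔ α i ≠ 0 := by
  refine ⟨fun h => Nat.one_le_iff_ne_zero.1 (by simpa using h i), fun h j => ?_⟩
  rcases eq_or_ne j i with rfl | hj
  · simpa using Nat.one_le_iff_ne_zero.2 h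
  · simp [hj]

theorem mem_wanderingSubspace_iff [CompleteSpace E] {S : Fin d → E →L[ℂ] E} {L : Submodule ℂ E}
    {x : E} : x ∈ wanderingSubspace S L ↔ x ∈ L ∧ ∀ i, adjoint (S i) x ∈ Lᗮ := by
  simp only [wanderingSubspace, Submodule.mem_inf, ← Submodule.iInf_orthogonal, Submodule.mem_iInf,
    Submodule.mem_orthogonal, Submodule.mem_map, forall_exists_index, and_imp,
    forall_apply_eq_imp_iff₂, adjoint_inner_right, ContinuousLinearMap.coe_coe]

theorem inner_tuplePow_eq_zero {S : Fin d → E →L[ℂ] E} (hS : ∀ i j, Commute (S i) (S j))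
    {L : Submodule ℂ E} (hL : ∀ i, ∀ x ∈ L, S i x ∈ L) {x y : E} (hx : x ∈ wanderingSubspace S L)
    (hy : y ∈ L) {α : Fin d → ℕ} (hα : α ≠ 0) : inner ℂ x (tuplePow S α y) = 0 := by
  obtain ⟨i, hi⟩ := Function.ne_iff.1 hα
  have hmem : tuplePow S α y ∈ L.map (S i).toLinearMap := by
    rw [← add_tsub_cancel_of_le (single_le_iff.2 hi), tuplePow_add hS, tuplePow_single hS]
    exact Submodule.mem_map_of_mem (tuplePow_mem hL _ hy)
  exact Submodule.inner_left_of_mem_orthogonal (Submodule.mem_iSup_of_mem i hmem) hx.2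

end Tuples

theorem isClosed_range_of_apply_apply_apply_eq {X Y : Type*} [TopologicalSpace X]
    [TopologicalSpace Y] [T2Space Y] {f : X → Y} {g : Y → X} (hf : Continuous f)
    (hg : Continuous g) (h : ∀ x, f (g (f x)) = f x) : IsClosed (Set.range f) := by
  have hrange : Set.range f = {y | f (g y) = y} := by
    ext y
    refine ⟨?_, fun hy => ⟨g y, hy⟩⟩
    rintro ⟨x, rfl⟩
    exact h x
  rw [hrange]
  exact isClosed_eq (hf.comp hg) continuous_id

section MultiIndex

variable {d : ℕ}

theorem sum_add_single (α : Fin d → ℕ) (i : Fin d) :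
    ∑ j, (α + Pi.single i 1 : Fin d → ℕ) j = ∑ j, α j + 1 := by
  simp [Finset.sum_add_distrib]

theorem prod_pow_add_single {R : Type*} [CommMonoid R] (z : Fin d → R) (α : Fin d → ℕ)
    (i : Fin d) : ∏ j, z j ^ (α + Pi.single i 1 : Fin d → ℕ) j = (∏ j, z j ^ α j) * z i := by
  simp only [Pi.add_apply, pow_add, Finset.prod_mul_distrib]
  rw [Finset.prod_eq_single i (f := fun j => z j ^ (Pi.single i 1 : Fin d → ℕ) j)]
    <;> simp +contextual

theorem prod_factorial_add_single (α : Fin d → ℕ) (i : Fin d) :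
    ∏ j, ((α + Pi.single i 1 : Fin d → ℕ) j).factorial = (α i + 1) * ∏ j, (α j).factorial := by
  rw [← Finset.mul_prod_erase _ _ (Finset.mem_univ i),
    ← Finset.mul_prod_erase Finset.univ (fun j => (α j).factorial) (Finset.mem_univ i), ← mul_assoc]
  congr 1
  · simp [Nat.factorial_succ]
  · exact Finset.prod_congr rfl fun j hj => by simp [Finset.ne_of_mem_erase hj]

theorem multinomial_add_single (α : Fin d → ℕ) (i : Fin d) :
    (α i + 1) * Nat.multinomial Finset.univ (α + Pi.single i 1) =
      (∑ j, α j + 1) * Nat.multinomial Finset.univ α := by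
  have hspec := Nat.multinomial_spec Finset.univ (α + Pi.single i 1)
  rw [prod_factorial_add_single, sum_add_single, Nat.factorial_succ,
    ← Nat.multinomial_spec Finset.univ α] at hspec
  apply Nat.eq_of_mul_eq_mul_left (Finset.prod_pos fun j _ => Nat.factorial_pos (α j))
  linarith

theorem multinomial_zero : Nat.multinomial Finset.univ (0 : Fin d → ℕ) = 1 := by
  simp [Nat.multinomial]

theorem KernelSeq.wt_zero (κ : KernelSeq) : κ.wt (0 : Fin d → ℕ) = 1 := by
  simp [wt, κ.a_zero, multinomial_zero]

theorem KernelSeq.wt_add_single (κ : KernelSeq) (α : Fin d → ℕ) (i : Fin d) :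
    κ.a (∑ j, α j + 1) / κ.a (∑ j, α j) * κ.wt α =
      (α i + 1) / (∑ j, α j + 1 : ℕ) * κ.wt (α + Pi.single i 1) := by
  have hmult : ((α i + 1 : ℕ) : ℝ) * Nat.multinomial Finset.univ (α + Pi.single i 1) =
      (∑ j, α j + 1 : ℕ) * Nat.multinomial Finset.univ α := by
    exact_mod_cast multinomial_add_single α i
  have ha := (κ.a_pos (∑ j, α j)).ne'
  have hsum : ((∑ j, α j + 1 : ℕ) : ℝ) ≠ 0 := by positivity
  rw [wt, wt, sum_add_single, div_mul_eq_mul_div, div_mul_eq_mul_div, div_eq_div_iff ha hsum]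
  push_cast at hmult ⊢
  linear_combination (-(κ.a (∑ j, α j + 1) * κ.a (∑ j, α j))) * hmult

end MultiIndex

namespace HK

open ContinuousLinearMap (adjoint adjoint_inner_left adjoint_inner_right)

variable {κ : KernelSeq} {d : ℕ} {E : Type*} [NormedAddCommGroup E] [InnerProductSpace ℂ E]

theorem seq_backShift (i : Fin d) (f : HK κ d E) (α : Fin d → ℕ) :
    seq (backShift κ E i f) α =
      ((Real.sqrt (κ.wt α / κ.wt (α + Pi.single i 1)) : ℝ) : ℂ) • seq f (α + Pi.single i 1) := rfl

theorem coeff_backShift (i : Fin d) (f : HK κ d E) (α : Fin d → ℕ) :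
    coeff (backShift κ E i f) α =
      ((κ.wt α / κ.wt (α + Pi.single i 1) : ℝ) : ℂ) • coeff f (α + Pi.single i 1) := by
  rw [coeff, coeff, seq_backShift, smul_smul, smul_smul, ← Complex.ofReal_mul,
    ← Complex.ofReal_mul]
  congr 2
  rw [Real.sqrt_div (κ.wt_pos α).le, ← mul_div_assoc, Real.mul_self_sqrt (κ.wt_pos α).le,
    div_mul_eq_mul_div, mul_div_assoc, Real.sqrt_div_self', mul_one_div]

variable [CompleteSpace E]

theorem adjoint_Mz (i : Fin d) : adjoint (Mz κ E i) = backShift κ E i := by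
  rw [Mz, ContinuousLinearMap.adjoint_adjoint]

theorem sum_apply {ι : Type*} (s : Finset ι) (f : ι → HK κ d E) (z : UBall d) :
    (∑ i ∈ s, f i) z = ∑ i ∈ s, f i z := by
  change RKHS.coeCLM ℂ (∑ i ∈ s, f i) z = _
  rw [map_sum, Finset.sum_apply]
  rfl

theorem commute_Mz (i k : Fin d) : Commute (Mz κ E i) (Mz κ E k) :=
  ContinuousLinearMap.ext fun f => RKHS.ext fun z => by
    simp only [mul_apply_eq_comp, Mz_apply, smul_comm (z.1 i)]

/-- The centre of the unit ball. -/
def origin (d : ℕ) : UBall d := ⟨0, by simp⟩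

theorem apply_origin (f : HK κ d E) : f (origin d) = coeff f 0 := by
  refine (hasSum_apply f (origin d)).unique ?_
  convert hasSum_single (0 : Fin d → ℕ) fun α hα => ?_ using 1
  · simp
  · obtain ⟨i, hi⟩ := Function.ne_iff.1 hα
    rw [Finset.prod_eq_zero (Finset.mem_univ i) (zero_pow hi), zero_smul]

variable (κ d E) in
/-- The embedding of `E` into `H_K(E)` as the space of constant functions; it is a kernel function
because `K(·, 0) = 1`. -/
noncomputable def const : E →L[ℂ] HK κ d E := RKHS.kerFun (HK κ d E) (origin d)

theorem inner_const (v : E) (f : HK κ d E) :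
    inner ℂ (const κ d E v) f = inner ℂ v (f (origin d)) :=
  RKHS.kerFun_inner _ _ _

theorem const_apply (v : E) (z : UBall d) : const κ d E v z = v := by
  have hk : κ.k 0 = 1 := by
    rw [KernelSeq.k, tsum_eq_single 0 fun n hn => by simp [hn]]
    simp [κ.a_zero]
  simp [const, RKHS.kerFun_apply, kernel_eq, origin, hk]

theorem backShift_const (i : Fin d) (v : E) : backShift κ E i (const κ d E v) = 0 := by
  rw [const, kerFun_eq, backShift_kvec]
  simp [origin]

theorem coeff_Delta_backShift (i : Fin d) (f : HK κ d E) (α : Fin d → ℕ) :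
    coeff (Delta κ d E (backShift κ E i f)) α =
      (((α i + 1) / (∑ j, α j + 1 : ℕ) : ℝ) : ℂ) • coeff f (α + Pi.single i 1) := by
  rw [coeff_Delta, coeff_backShift, smul_smul, ← Complex.ofReal_mul, ← mul_div_assoc,
    κ.wt_add_single, mul_div_cancel_right₀ _ (κ.wt_pos _).ne']

theorem hasSum_Mz_Delta_backShift (i : Fin d) (f : HK κ d E) (z : UBall d) :
    HasSum (fun β : Fin d → ℕ => (((β i) / (∑ j, β j : ℕ) : ℝ) : ℂ) •
      (∏ j, z.1 j ^ β j) • coeff f β) (Mz κ E i (Delta κ d E (backShift κ E i f)) z) := by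
  rw [← (add_left_injective (Pi.single i 1 : Fin d → ℕ)).hasSum_iff, Mz_apply]
  · refine ((hasSum_apply (Delta κ d E (backShift κ E i f)) z).const_smul (z.1 i)).congr_fun
      fun α => ?_
    rw [Function.comp_apply, prod_pow_add_single, sum_add_single, coeff_Delta_backShift,
      smul_smul, smul_smul, smul_smul]
    congr 1
    simp only [Pi.add_apply, Pi.single_eq_same]
    push_cast
    ring
  · intro β hβ
    have hβi : β i = 0 := by
      by_contra h
      exact hβ ⟨β - Pi.single i 1, tsub_add_cancel_of_le (single_le_iff.2 h)⟩
    simp [hβi]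

theorem sum_div_sum_eq_one {β : Fin d → ℕ} (hβ : β ≠ 0) :
    ∑ i, (((β i) / (∑ j, β j : ℕ) : ℝ) : ℂ) = 1 := by
  have hsum : (∑ j, β j : ℕ) ≠ 0 := fun h =>
    hβ (funext fun i => Finset.sum_eq_zero_iff.1 h i (Finset.mem_univ i))
  rw [← Complex.ofReal_sum, ← Finset.sum_div, ← Nat.cast_sum, div_self (Nat.cast_ne_zero.2 hsum),
    Complex.ofReal_one]

variable (κ d E) in
/-- The row operator `M_z (⊕ Δ) : H_K(E)^d → H_K(E)`, a right inverse of `M_z^*` on the range of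
`M_z^*`. -/
noncomputable def rowMzDelta : PiLp 2 (fun _ : Fin d => HK κ d E) →L[ℂ] HK κ d E :=
  rowOp (Mz κ E) ∘L oplus d (Delta κ d E)

theorem rowMzDelta_apply (x : PiLp 2 (fun _ : Fin d => HK κ d E)) :
    rowMzDelta κ d E x = ∑ i, Mz κ E i (Delta κ d E (x i)) :=
  rowOp_comp_oplus_apply _ _ _

theorem adjoint_rowOp_Mz_apply (f : HK κ d E) (i : Fin d) :
    adjoint (rowOp (Mz κ E)) f i = backShift κ E i f := by
  rw [adjoint_rowOp_apply, adjoint_Mz]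

theorem adjoint_rowOp_Mz_const (v : E) : adjoint (rowOp (Mz κ E)) (const κ d E v) = 0 :=
  PiLp.ext fun i => (adjoint_rowOp_Mz_apply _ i).trans (backShift_const i v)

theorem eq_const_add_rowMzDelta (f : HK κ d E) :
    f = const κ d E (f (origin d)) + rowMzDelta κ d E (adjoint (rowOp (Mz κ E)) f) := by
  refine RKHS.ext fun z => (hasSum_apply f z).unique ?_
  rw [RKHS.coe_add, Pi.add_apply, const_apply, apply_origin, rowMzDelta_apply, sum_apply]
  simp only [adjoint_rowOp_Mz_apply]
  refine ((hasSum_ite_eq (0 : Fin d → ℕ) (coeff f 0)).add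
    (hasSum_sum fun i _ => hasSum_Mz_Delta_backShift i f z)).congr_fun fun β => ?_
  rw [← Finset.sum_smul]
  split_ifs with hβ
  · simp [hβ]
  · rw [sum_div_sum_eq_one hβ, one_smul, zero_add]

theorem adjoint_rowOp_Mz_rowMzDelta (f : HK κ d E) :
    adjoint (rowOp (Mz κ E)) (rowMzDelta κ d E (adjoint (rowOp (Mz κ E)) f)) =
      adjoint (rowOp (Mz κ E)) f := by
  conv_rhs => rw [eq_const_add_rowMzDelta f, map_add, adjoint_rowOp_Mz_const, zero_add]

theorem norm_sq_eq (f : HK κ d E) :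
    ‖f‖ ^ 2 = ‖f (origin d)‖ ^ 2 +
      ∑ i, (inner ℂ (Delta κ d E (backShift κ E i f)) (backShift κ E i f)).re := by
  have h : inner ℂ f f = inner ℂ (f (origin d)) (f (origin d)) +
      ∑ i, inner ℂ (Delta κ d E (backShift κ E i f)) (backShift κ E i f) := by
    refine (congrArg (fun g => inner ℂ g f) (eq_const_add_rowMzDelta f)).trans ?_
    simp only [inner_add_left, inner_const, rowMzDelta_apply, sum_inner, adjoint_rowOp_Mz_apply,
      ← adjoint_Mz, adjoint_inner_right]
  have hre := congrArg Complex.re h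
  rw [Complex.add_re, Complex.re_sum, inner_self_eq_norm_sq_to_K, inner_self_eq_norm_sq_to_K] at hre
  exact_mod_cast hre

end HK

namespace PureKContraction

open ContinuousLinearMap (adjoint adjoint_inner_left adjoint_inner_right)

variable {κ : KernelSeq} {d : ℕ} {H : Type*} [NormedAddCommGroup H] [InnerProductSpace ℂ H]
  [CompleteSpace H] (S : PureKContraction κ d H)

theorem commute_adjoint (i k : Fin d) : Commute (adjoint (S.T i)) (adjoint (S.T k)) :=
  (S.isKContraction.1 i k).star_star

theorem adjPow_add_single (α : Fin d → ℕ) (i : Fin d) (h : H) :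
    S.adjPow (α + Pi.single i 1) h = S.adjPow α (adjoint (S.T i) h) := by
  rw [adjPow, tuplePow_add S.commute_adjoint, tuplePow_single S.commute_adjoint]
  rfl

theorem C_nonneg : 0 ≤ S.C := CFC.sqrt_nonneg _

theorem adjoint_C : adjoint S.C = S.C := (IsSelfAdjoint.of_nonneg S.C_nonneg).adjoint_eq

theorem seq_j (h : H) (α : Fin d → ℕ) :
    HK.seq (S.j h) α = ((Real.sqrt (κ.wt α) : ℝ) : ℂ) • S.C' (S.adjPow α h) := rfl

theorem j_adjoint (i : Fin d) (h : H) :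
    S.j (adjoint (S.T i) h) = HK.backShift κ S.defectSpace i (S.j h) := by
  apply HK.seq.injective
  refine lp.ext (funext fun α => ?_)
  rw [HK.seq_backShift, S.seq_j, S.seq_j, S.adjPow_add_single, smul_smul, ← Complex.ofReal_mul,
    ← Real.sqrt_mul (div_pos (κ.wt_pos _) (κ.wt_pos _)).le, div_mul_cancel₀ _ (κ.wt_pos _).ne']

/-- The adjoint `j^*` of the canonical dilation. -/
noncomputable def jAdj : HK κ d S.defectSpace →L[ℂ] H := adjoint S.j.toContinuousLinearMap

theorem inner_jAdj (f : HK κ d S.defectSpace) (h : H) :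
    inner ℂ (S.jAdj f) h = inner ℂ f (S.j h) :=
  adjoint_inner_left S.j.toContinuousLinearMap h f

theorem jAdj_j (h : H) : S.jAdj (S.j h) = h :=
  ext_inner_right ℂ fun y => by rw [inner_jAdj, LinearIsometry.inner_map_map]

theorem jAdj_Mz (i : Fin d) (f : HK κ d S.defectSpace) :
    S.jAdj (HK.Mz κ S.defectSpace i f) = S.T i (S.jAdj f) :=
  ext_inner_right ℂ fun h => by
    rw [inner_jAdj, ← adjoint_inner_right, HK.adjoint_Mz, ← j_adjoint, ← inner_jAdj,
      adjoint_inner_right]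

theorem j_apply_origin (h : H) : S.j h (HK.origin d) = S.C' h := by
  rw [HK.apply_origin, coeff_j, κ.wt_zero, adjPow, tuplePow_zero]
  simp

theorem jAdj_const (v : S.defectSpace) : S.jAdj (HK.const κ d S.defectSpace v) = S.C v :=
  ext_inner_right ℂ fun h => by
    rw [inner_jAdj, HK.inner_const, j_apply_origin, ← adjoint_inner_right, adjoint_C]
    rfl

theorem mem_M {f : HK κ d S.defectSpace} : f ∈ S.M ↔ S.jAdj f = 0 := by
  rw [M, show S.j.toLinearMap = S.j.toContinuousLinearMap from rfl,
    ContinuousLinearMap.orthogonal_range]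
  rfl

theorem Mz_mem_M (i : Fin d) (f : HK κ d S.defectSpace) (hf : f ∈ S.M) :
    HK.Mz κ S.defectSpace i f ∈ S.M := by
  rw [mem_M] at hf ⊢
  rw [jAdj_Mz, hf, map_zero]

theorem M_orthogonal : S.Mᗮ = S.j.toLinearMap.range := by
  have hclosed : IsClosed (S.j.toLinearMap.range : Set (HK κ d S.defectSpace)) := by
    rw [LinearMap.coe_range]
    exact S.j.isometry.isClosedEmbedding.isClosed_range
  rw [M, Submodule.orthogonal_orthogonal_eq_closure]
  exact hclosed.submodule_topologicalClosure_eq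

/-- The operator `⊕ j I_T⁻¹ : H̃^d → H_K(𝒟)^d`. -/
noncomputable def jTilde : PiLp 2 (fun _ : Fin d => S.HTilde) →L[ℂ]
    PiLp 2 (fun _ : Fin d => HK κ d S.defectSpace) :=
  oplus d S.j.toContinuousLinearMap ∘L oplus d (S.IT.symm : S.HTilde →L[ℂ] H)

theorem jTilde_apply (y : PiLp 2 fun _ : Fin d => S.HTilde) (i : Fin d) :
    S.jTilde y i = S.j (S.IT.symm (y i)) := rfl

theorem adjoint_IT (y : S.HTilde) :
    adjoint (S.IT : H →L[ℂ] S.HTilde) y = S.DeltaT (S.IT.symm y) :=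
  ext_inner_right ℂ fun h => by
    rw [adjoint_inner_left]
    rfl

theorem rowTilde_apply (y : PiLp 2 fun _ : Fin d => S.HTilde) :
    S.rowTilde y = ∑ i, S.T i (S.DeltaT (S.IT.symm (y i))) := by
  simp only [rowTilde, rowOp_apply, ContinuousLinearMap.comp_apply, adjoint_IT]

theorem adjoint_rowTilde_apply (h : H) (i : Fin d) :
    adjoint S.rowTilde h i = S.IT (adjoint (S.T i) h) := by
  rw [rowTilde, adjoint_rowOp_apply, ContinuousLinearMap.adjoint_comp,
    ContinuousLinearMap.adjoint_adjoint]
  rfl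

theorem colMzAdj_apply (f : HK κ d S.defectSpace) (i : Fin d) :
    S.colMzAdj f i = HK.backShift κ S.defectSpace i f :=
  HK.adjoint_rowOp_Mz_apply f i

theorem colMzAdj_j (h : H) : S.colMzAdj (S.j h) = S.jTilde (adjoint S.rowTilde h) :=
  PiLp.ext fun i => by
    rw [colMzAdj_apply, jTilde_apply, adjoint_rowTilde_apply,
      ContinuousLinearEquiv.symm_apply_apply, j_adjoint]

theorem jAdj_rowMzDelta_jTilde (y : PiLp 2 fun _ : Fin d => S.HTilde) :
    S.jAdj (HK.rowMzDelta κ d S.defectSpace (S.jTilde y)) = S.rowTilde y := by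
  simp only [HK.rowMzDelta_apply, map_sum, jAdj_Mz, rowTilde_apply, jTilde_apply]
  rfl

theorem sum_inner_Delta_jTilde (y : PiLp 2 fun _ : Fin d => S.HTilde) :
    ∑ i, (inner ℂ (HK.Delta κ d S.defectSpace (S.jTilde y i)) (S.jTilde y i)).re = ‖y‖ ^ 2 := by
  rw [PiLp.norm_sq_eq_of_L2]
  refine Finset.sum_congr rfl fun i _ => ?_
  rw [jTilde_apply, ← inner_DeltaT, ← tilde_norm_sq]
  rfl

theorem mem_range_jTilde_iff {f : PiLp 2 fun _ : Fin d => HK κ d S.defectSpace} :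
    f ∈ Set.range S.jTilde ↔ ∀ i, f i ∈ Set.range S.j := by
  constructor
  · rintro ⟨y, rfl⟩ i
    exact ⟨S.IT.symm (y i), rfl⟩
  · intro h
    choose x hx using h
    exact ⟨WithLp.toLp 2 fun i => S.IT (x i), PiLp.ext hx⟩

theorem mem_wanderingSubspace_M_iff {f : HK κ d S.defectSpace} :
    f ∈ wanderingSubspace (HK.Mz κ S.defectSpace) S.M ↔
      S.jAdj f = 0 ∧ S.colMzAdj f ∈ Set.range S.jTilde := by
  simp only [mem_wanderingSubspace_iff, mem_M, M_orthogonal, mem_range_jTilde_iff, colMzAdj_apply,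
    HK.adjoint_Mz]
  rfl

theorem rowTilde_comp_adjoint : S.rowTilde ∘L adjoint S.rowTilde = 1 - S.C * S.C := by
  ext1 h
  have hj := congrArg S.jAdj (HK.eq_const_add_rowMzDelta (S.j h))
  rw [map_add, jAdj_j, jAdj_const, j_apply_origin] at hj
  rw [ContinuousLinearMap.comp_apply, ← jAdj_rowMzDelta_jTilde, ← colMzAdj_j]
  exact eq_sub_of_add_eq' hj.symm

theorem norm_rowTilde_le_one : ‖S.rowTilde‖ ≤ 1 := by
  rw [← LinearIsometryEquiv.norm_map adjoint, ← adjoint_comp_self_le_one_iff,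
    ContinuousLinearMap.adjoint_adjoint, rowTilde_comp_adjoint]
  exact sub_le_self _ (IsSelfAdjoint.of_nonneg S.C_nonneg).mul_self_nonneg

theorem defectOp_adjoint_rowTilde : defectOp (adjoint S.rowTilde) = S.C := by
  rw [defectOp, ContinuousLinearMap.adjoint_adjoint, rowTilde_comp_adjoint, sub_sub_cancel,
    CFC.sqrt_mul_self _ S.C_nonneg]

theorem rowTilde_defectTilde (y : PiLp 2 fun _ : Fin d => S.HTilde) :
    S.rowTilde (S.defectTilde y) = S.C (S.rowTilde y) := by
  rw [defectTilde, apply_defectOp S.norm_rowTilde_le_one, defectOp_adjoint_rowTilde]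

end PureKContraction

section CoefficientGrowth

theorem exists_forall_le_mul_of_eventually_le_succ {u : ℕ → ℝ} (hu : ∀ n, 0 < u n)
    (h : ∀ᶠ n in atTop, u n ≤ u (n + 1)) : ∃ w, 0 < w ∧ ∀ m k, m ≤ k → u m ≤ w * u k := by
  obtain ⟨N, hN⟩ := eventually_atTop.1 h
  have hmono {m k : ℕ} (hm : N ≤ m) (hmk : m ≤ k) : u m ≤ u k := by
    induction k, hmk using Nat.le_induction with
    | base => exact le_rfl
    | succ k hk ih => exact ih.trans (hN k (hm.trans hk))
  set A := ∑ i ∈ Finset.range (N + 1), u i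
  set B := ∑ i ∈ Finset.range (N + 1), (u i)⁻¹
  have hA {m : ℕ} (hm : m ≤ N) : u m ≤ A :=
    Finset.single_le_sum (fun i _ => (hu i).le) (Finset.mem_range_succ_iff.2 hm)
  have hB {k : ℕ} (hk : k ≤ N) : 1 ≤ B * u k := by
    rw [← inv_le_iff_one_le_mul₀ (hu k)]
    exact Finset.single_le_sum (f := fun i => (u i)⁻¹) (fun i _ => (inv_pos.2 (hu i)).le)
      (Finset.mem_range_succ_iff.2 hk)
  have hA0 : 0 < A := (hu N).trans_le (hA le_rfl)
  have hB0 : 0 < B := pos_of_mul_pos_left (zero_lt_one.trans_le (hB le_rfl)) (hu N).le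
  refine ⟨1 + A * B, by positivity, fun m k hmk => ?_⟩
  have hk := hu k
  rcases le_total N m with hm | hm
  · nlinarith [hmono hm hmk, mul_pos hA0 hB0]
  · have hmin : u (min k N) ≤ u k := by
      rcases le_total k N with h | h
      · rw [min_eq_left h]
      · rw [min_eq_right h]
        exact hmono le_rfl h
    calc u m ≤ A * (B * u (min k N)) :=
          (hA hm).trans (le_mul_of_one_le_right hA0.le (hB (min_le_right k N)))
      _ ≤ A * (B * u k) := by gcongr
      _ ≤ (1 + A * B) * u k := by nlinarith

namespace KernelSeq

variable (κ : KernelSeq)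

theorem tendsto_norm_div_norm_mul_pow {R t : ℝ}
    (hR : Tendsto (fun n => κ.a n / κ.a (n + 1)) atTop (𝓝 R)) (hR0 : R ≠ 0) (ht : 0 < t) :
    Tendsto (fun n => ‖κ.a (n + 1) * t ^ (n + 1)‖ / ‖κ.a n * t ^ n‖) atTop (𝓝 (t / R)) := by
  refine (tendsto_const_nhds.div hR hR0).congr fun n => ?_
  have ha := κ.a_pos n
  have ha' := κ.a_pos (n + 1)
  rw [Real.norm_of_nonneg (by positivity), Real.norm_of_nonneg (by positivity), pow_succ,
    Pi.div_apply]
  field_simp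

theorem one_le_of_tendsto_ratio {R : ℝ}
    (hR : Tendsto (fun n => κ.a n / κ.a (n + 1)) atTop (𝓝 R)) : 1 ≤ R := by
  have hR0 : 0 < R := κ.ratio_inf_pos.trans_le <| ge_of_tendsto' hR fun n =>
    ciInf_le ⟨0, by rintro _ ⟨m, rfl⟩; exact (div_pos (κ.a_pos _) (κ.a_pos _)).le⟩ n
  by_contra! hR1
  obtain ⟨ρ, hRρ, hρ1⟩ := exists_between hR1
  have hρ : 0 < ρ := hR0.trans hRρ
  have hsum : Summable fun n => κ.a n * ρ ^ n := by
    have := κ.summable_disc (ρ : ℂ) (by rwa [Complex.norm_real, Real.norm_of_nonneg hρ.le])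
    exact_mod_cast this
  exact not_summable_of_ratio_test_tendsto_gt_one ((one_lt_div hR0).2 hRρ)
    (κ.tendsto_norm_div_norm_mul_pow hR hR0.ne' hρ) hsum

theorem exists_le_mul_pow_mul {R Q : ℝ}
    (hR : Tendsto (fun n => κ.a n / κ.a (n + 1)) atTop (𝓝 R)) (hRQ : R < Q) :
    ∃ w, 0 < w ∧ ∀ m n, κ.a m ≤ w * Q ^ n * κ.a (m + n) := by
  have hQ : 0 < Q := zero_lt_one.trans_le (κ.one_le_of_tendsto_ratio hR) |>.trans hRQ
  obtain ⟨w, hw, hle⟩ := exists_forall_le_mul_of_eventually_le_succ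
    (u := fun n => κ.a n * Q ^ n) (fun n => mul_pos (κ.a_pos n) (pow_pos hQ n)) <| by
      filter_upwards [hR.eventually_lt_const hRQ] with n hn
      rw [pow_succ', ← mul_assoc]
      gcongr
      rw [mul_comm]
      exact ((div_lt_iff₀ (κ.a_pos _)).1 hn).le
  refine ⟨w, hw, fun m n => le_of_mul_le_mul_right ?_ (pow_pos hQ m)⟩
  calc κ.a m * Q ^ m ≤ w * (κ.a (m + n) * Q ^ (m + n)) := hle m (m + n) (Nat.le_add_right m n)
    _ = w * Q ^ n * κ.a (m + n) * Q ^ m := by rw [pow_add]; ring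

theorem summable_mul_pow {R t : ℝ}
    (hR : Tendsto (fun n => κ.a n / κ.a (n + 1)) atTop (𝓝 R)) (ht : 0 < t) (htR : t < R) :
    Summable fun n => κ.a n * t ^ n := by
  have hR0 : 0 < R := ht.trans htR
  exact summable_of_ratio_test_tendsto_lt_one ((div_lt_one hR0).2 htR)
    (Eventually.of_forall fun n => mul_ne_zero (κ.a_pos n).ne' (pow_ne_zero n ht.ne'))
    (κ.tendsto_norm_div_norm_mul_pow hR hR0.ne' ht)

/- With `R = lim aₙ / aₙ₊₁ ≥ 1`, take `B n` a multiple of `q ^ n` with `R < q < R / r`: then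
`R < q²`, and `q r` lies inside the radius of convergence `R` of `∑ aₙ zⁿ`. -/
theorem exists_le_sq_mul_and_summable {r : ℝ} (hr0 : 0 < r) (hr : r < 1) : ∃ B : ℕ → ℝ,
    (∀ n, 0 ≤ B n) ∧ (∀ m n, κ.a m ≤ B n ^ 2 * κ.a (m + n)) ∧
      Summable fun n => κ.a (n + 1) * B n * r ^ n := by
  obtain ⟨R, hR⟩ := κ.ratio_tendsto
  have hR1 := κ.one_le_of_tendsto_ratio hR
  obtain ⟨q, hRq, hqr⟩ := exists_between
    (show R < R / r from (lt_div_iff₀ hr0).2 (by nlinarith))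
  have hq : 0 < q := by linarith
  obtain ⟨w, hw, hle⟩ := κ.exists_le_mul_pow_mul hR (show R < q ^ 2 by nlinarith)
  refine ⟨fun n => Real.sqrt w * q ^ n, fun n => by positivity, fun m n => ?_, ?_⟩
  · rw [mul_pow, Real.sq_sqrt hw.le, ← pow_mul, mul_comm n, pow_mul]
    exact hle m n
  · have hsum := (summable_nat_add_iff 1).2
      (κ.summable_mul_pow hR (mul_pos hq hr0) ((lt_div_iff₀ hr0).1 hqr))
    refine (hsum.mul_left (Real.sqrt w * (q * r)⁻¹)).congr fun n => ?_
    rw [pow_succ, mul_pow]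
    field_simp

end KernelSeq

end CoefficientGrowth

section PowerSeries

theorem norm_sum_smul_sq_le {𝕜 ι E : Type*} [RCLike 𝕜] [Fintype ι] [SeminormedAddCommGroup E]
    [NormedSpace 𝕜 E] (z : EuclideanSpace 𝕜 ι) (u : ι → E) :
    ‖∑ i, z i • u i‖ ^ 2 ≤ ‖z‖ ^ 2 * ∑ i, ‖u i‖ ^ 2 := by
  rw [EuclideanSpace.norm_sq_eq]
  refine (pow_le_pow_left₀ (norm_nonneg _) (norm_sum_le _ _) 2).trans ?_
  simp only [norm_smul]
  exact Finset.sum_mul_sq_le_sq_mul_sq _ _ _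

namespace PureKContraction

variable {κ : KernelSeq} {d : ℕ} {H : Type*} [NormedAddCommGroup H] [InnerProductSpace ℂ H]
  [CompleteSpace H] (S : PureKContraction κ d H)

open ContinuousLinearMap (adjoint adjoint_inner_left)

/-- The quadratic form `⟨σ_Tᵐ((1/K)(T)) h, h⟩`, in the expanded form given by `inner_sigma`. -/
noncomputable def defectForm (m : ℕ) (h : H) : ℝ :=
  ∑ α ∈ Finset.piAntidiag Finset.univ m,
    (Nat.multinomial Finset.univ α : ℝ) * ‖S.C (S.adjPow α h)‖ ^ 2

theorem defectForm_nonneg (m : ℕ) (h : H) : 0 ≤ S.defectForm m h :=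
  Finset.sum_nonneg fun _ _ => by positivity

theorem defectForm_succ (m : ℕ) (h : H) :
    S.defectForm (m + 1) h = ∑ i, S.defectForm m (adjoint (S.T i) h) := by
  have hσ : inner ℂ h ((sigmaMap S.T)^[m + 1] (recipK κ S.T) h) = ∑ i,
      inner ℂ (adjoint (S.T i) h) ((sigmaMap S.T)^[m] (recipK κ S.T) (adjoint (S.T i) h)) := by
    rw [Function.iterate_succ_apply', sigmaMap, sum_apply, inner_sum]
    refine Finset.sum_congr rfl fun i _ => ?_
    rw [adjoint_inner_left]
    rfl
  simp only [S.inner_sigma] at hσ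
  exact_mod_cast hσ

theorem ZTadj_apply (z : EuclideanSpace ℂ (Fin d)) (h : H) :
    S.ZTadj z h = ∑ i, z i • adjoint (S.T i) h := by
  rw [ZTadj, sum_apply]
  rfl

theorem defectForm_ZTadj_le (m : ℕ) (z : EuclideanSpace ℂ (Fin d)) (h : H) :
    S.defectForm m (S.ZTadj z h) ≤ ‖z‖ ^ 2 * S.defectForm (m + 1) h := by
  rw [defectForm_succ]
  simp only [defectForm]
  rw [Finset.sum_comm, Finset.mul_sum]
  refine Finset.sum_le_sum fun α _ => ?_
  rw [← Finset.mul_sum, mul_left_comm, ZTadj_apply, map_sum, map_sum]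
  refine mul_le_mul_of_nonneg_left ?_ (Nat.cast_nonneg _)
  simp only [map_smul]
  exact norm_sum_smul_sq_le z _

theorem hasSum_defectForm (h : H) : HasSum (fun m => κ.a m * S.defectForm m h) (‖h‖ ^ 2) := by
  refine (hasSum_degree (S.hasSum_norm h)).congr_fun fun m => ?_
  rw [defectForm, Finset.mul_sum]
  refine Finset.sum_congr rfl fun α hα => ?_
  rw [KernelSeq.wt, (Finset.mem_piAntidiag.1 hα).1, mul_assoc]

theorem defectForm_prod_le (l : List (EuclideanSpace ℂ (Fin d))) (h : H) (m : ℕ) :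
    S.defectForm m ((l.map S.ZTadj).prod h) ≤
      (l.map norm).prod ^ 2 * S.defectForm (m + l.length) h := by
  induction l generalizing m with
  | nil => simp
  | cons z l ih =>
    rw [List.map_cons, List.map_cons, List.prod_cons, List.prod_cons, List.length_cons, mul_pow,
      mul_assoc]
    refine (S.defectForm_ZTadj_le m z _).trans ?_
    gcongr
    refine (ih (m + 1)).trans_eq ?_
    rw [Nat.add_right_comm, Nat.add_assoc]

theorem tsum_defectForm_add_le (n : ℕ) (h : H) :
    ∑' m, κ.a (m + n) * S.defectForm (m + n) h ≤ ‖h‖ ^ 2 := by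
  rw [← (S.hasSum_defectForm h).tsum_eq]
  exact tsum_comp_le_tsum_of_inj (S.hasSum_defectForm h).summable
    (fun m => mul_nonneg (κ.a_pos m).le (S.defectForm_nonneg m h)) (add_left_injective n)

theorem norm_prod_ZTadj_le {B : ℝ} (l : List (EuclideanSpace ℂ (Fin d))) (hB0 : 0 ≤ B)
    (hB : ∀ m, κ.a m ≤ B ^ 2 * κ.a (m + l.length)) :
    ‖(l.map S.ZTadj).prod‖ ≤ B * (l.map norm).prod := by
  have hl : 0 ≤ (l.map norm).prod := List.prod_nonneg fun x hx => by
    obtain ⟨z, _, rfl⟩ := List.mem_map.1 hx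
    exact norm_nonneg z
  refine ContinuousLinearMap.opNorm_le_bound _ (by positivity) fun h => ?_
  refine (sq_le_sq₀ (norm_nonneg _) (by positivity)).1 ?_
  have hterm (m : ℕ) : κ.a m * S.defectForm m ((l.map S.ZTadj).prod h) ≤
      (B * (l.map norm).prod) ^ 2 * (κ.a (m + l.length) * S.defectForm (m + l.length) h) :=
    calc κ.a m * S.defectForm m ((l.map S.ZTadj).prod h)
        ≤ (B ^ 2 * κ.a (m + l.length)) *
            ((l.map norm).prod ^ 2 * S.defectForm (m + l.length) h) :=
          mul_le_mul (hB m) (S.defectForm_prod_le l h m) (S.defectForm_nonneg _ _)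
            (mul_nonneg (sq_nonneg B) (κ.a_pos _).le)
      _ = _ := by ring
  have hsum : Summable fun m => κ.a (m + l.length) * S.defectForm (m + l.length) h :=
    (S.hasSum_defectForm h).summable.comp_injective (add_left_injective l.length)
  calc ‖(l.map S.ZTadj).prod h‖ ^ 2
      ≤ (B * (l.map norm).prod) ^ 2 *
          ∑' m, κ.a (m + l.length) * S.defectForm (m + l.length) h :=
        hasSum_le hterm (S.hasSum_defectForm _) (hsum.hasSum.mul_left _)
    _ ≤ (B * (l.map norm).prod * ‖h‖) ^ 2 := by
        rw [mul_pow _ ‖h‖]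
        gcongr
        exact S.tsum_defectForm_add_le _ h

/-- The continuous linear map `z ↦ Z T^*`. -/
noncomputable def ZTadjL : EuclideanSpace ℂ (Fin d) →L[ℂ] (H →L[ℂ] H) :=
  ∑ i, (EuclideanSpace.proj i : EuclideanSpace ℂ (Fin d) →L[ℂ] ℂ).smulRight (adjoint (S.T i))

theorem ZTadjL_apply (z : EuclideanSpace ℂ (Fin d)) : S.ZTadjL z = S.ZTadj z := by
  rw [ZTadjL, sum_apply, ZTadj]
  rfl

/-- The power series of `z ↦ F(Z T^*)` at the origin. -/
noncomputable def FTSeries : FormalMultilinearSeries ℂ (EuclideanSpace ℂ (Fin d)) (H →L[ℂ] H) :=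
  fun n => (κ.a (n + 1) : ℂ) •
    (ContinuousMultilinearMap.mkPiAlgebraFin ℂ n (H →L[ℂ] H)).compContinuousLinearMap
      fun _ => S.ZTadjL

theorem FTSeries_apply (n : ℕ) (v : Fin n → EuclideanSpace ℂ (Fin d)) :
    S.FTSeries n v = (κ.a (n + 1) : ℂ) • ((List.ofFn v).map S.ZTadj).prod := by
  rw [List.map_ofFn]
  simp only [FTSeries, smul_apply, ContinuousMultilinearMap.compContinuousLinearMap_apply,
    ContinuousMultilinearMap.mkPiAlgebraFin_apply, ZTadjL_apply]
  rfl

theorem FTSeries_apply_const (n : ℕ) (z : EuclideanSpace ℂ (Fin d)) :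
    (S.FTSeries n fun _ => z) = (κ.a (n + 1) : ℂ) • S.ZTadj z ^ n := by
  rw [FTSeries_apply, List.ofFn_const, List.map_replicate, List.prod_replicate]

theorem FTSeries_sum : S.FTSeries.sum = S.FT :=
  funext fun z => tsum_congr fun n => S.FTSeries_apply_const n z

theorem norm_FTSeries_le {n : ℕ} {B : ℝ} (hB0 : 0 ≤ B)
    (hB : ∀ m, κ.a m ≤ B ^ 2 * κ.a (m + n)) : ‖S.FTSeries n‖ ≤ κ.a (n + 1) * B := by
  have ha := κ.a_pos (n + 1)
  refine ContinuousMultilinearMap.opNorm_le_bound (by positivity) fun v => ?_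
  rw [FTSeries_apply, norm_smul, Complex.norm_real, Real.norm_of_nonneg ha.le, mul_assoc]
  gcongr
  refine (S.norm_prod_ZTadj_le (List.ofFn v) hB0 (by simpa using hB)).trans_eq ?_
  rw [List.map_ofFn, List.prod_ofFn]
  rfl

theorem one_le_radius_FTSeries : 1 ≤ S.FTSeries.radius := by
  refine ENNReal.le_of_forall_nnreal_lt fun r hr => ?_
  obtain ⟨ρ, hrρ, hρ1⟩ := exists_between (show (r : ℝ) < 1 by exact_mod_cast hr)
  obtain ⟨B, hB0, hB, hsum⟩ := κ.exists_le_sq_mul_and_summable (r.2.trans_lt hrρ) hρ1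
  refine S.FTSeries.le_radius_of_summable_norm (Summable.of_nonneg_of_le
    (fun n => by positivity) (fun n => ?_) hsum)
  have ha := κ.a_pos (n + 1)
  have hBn := hB0 n
  gcongr
  exact S.norm_FTSeries_le hBn fun m => hB m n

theorem UBall_subset_eball_radius : UBall d ⊆ Metric.eball 0 S.FTSeries.radius := by
  intro z hz
  refine Metric.eball_subset_eball S.one_le_radius_FTSeries ?_
  rwa [Metric.mem_eball, edist_dist, ENNReal.ofReal_lt_one]

theorem summable_FT {z : EuclideanSpace ℂ (Fin d)} (hz : z ∈ UBall d) :
    Summable fun n => (κ.a (n + 1) : ℂ) • S.ZTadj z ^ n :=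
  (S.FTSeries.summable (S.UBall_subset_eball_radius hz)).congr fun n =>
    S.FTSeries_apply_const n z

theorem analyticOnNhd_FT : AnalyticOnNhd ℂ S.FT (UBall d) := by
  have h := S.FTSeries.hasFPowerSeriesOnBall (zero_lt_one.trans_le S.one_le_radius_FTSeries)
  rw [FTSeries_sum] at h
  exact h.analyticOnNhd.mono S.UBall_subset_eball_radius

theorem Delta_j_apply (h : H) (z : UBall d) :
    HK.Delta κ d S.defectSpace (S.j h) z = S.C' (S.FT z.1 h) := by
  have hDelta := hasSum_degree (HK.hasSum_apply (HK.Delta κ d S.defectSpace (S.j h)) z)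
  have hFT := ((S.summable_FT z.2).hasSum.mapL (ContinuousLinearMap.apply ℂ H h)).mapL S.C'
  refine hDelta.unique (hFT.congr_fun fun n => ?_)
  change _ = S.C' ((κ.a (n + 1) : ℂ) • (S.ZTadj z.1 ^ n) h)
  rw [ZTadj, sum_smul_pow_eq S.commute_adjoint, sum_apply, map_smul, map_sum, Finset.smul_sum]
  refine Finset.sum_congr rfl fun α hα => ?_
  have hn : ∑ i, α i = n := (Finset.mem_piAntidiag.1 hα).1
  have ha : (κ.a n : ℂ) ≠ 0 := by exact_mod_cast (κ.a_pos n).ne'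
  rw [HK.coeff_Delta, coeff_j, KernelSeq.wt, hn, smul_apply, map_smul, smul_smul, smul_smul,
    smul_smul]
  congr 1
  push_cast
  field_simp

end PureKContraction

end PowerSeries

section InnerFunction

theorem analyticOnNhd_clm_comp {𝕜 D E F G : Type*} [NontriviallyNormedField 𝕜]
    [NormedAddCommGroup D] [NormedSpace 𝕜 D] [NormedAddCommGroup E] [NormedSpace 𝕜 E]
    [NormedAddCommGroup F] [NormedSpace 𝕜 F] [NormedAddCommGroup G] [NormedSpace 𝕜 G]
    {f : D → F →L[𝕜] G} {g : D → E →L[𝕜] F} {s : Set D} (hf : AnalyticOnNhd 𝕜 f s)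
    (hg : AnalyticOnNhd 𝕜 g s) : AnalyticOnNhd 𝕜 (fun z => f z ∘L g z) s := fun z hz =>
  AnalyticAt.comp₂ (h := fun p : (F →L[𝕜] G) × (E →L[𝕜] F) => p.1 ∘L p.2)
    ((ContinuousLinearMap.compL 𝕜 E F G).analyticAt_bilinear (f z, g z)) (hf z hz) (hg z hz)

theorem rowZ_apply {d : ℕ} {H : Type*} [NormedAddCommGroup H] [InnerProductSpace ℂ H]
    (z : EuclideanSpace ℂ (Fin d)) (x : PiLp 2 fun _ : Fin d => H) :
    rowZ H z x = ∑ i, z i • x i :=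
  rowOp_apply _ x

theorem analyticOnNhd_rowZ {d : ℕ} (H : Type*) [NormedAddCommGroup H] [InnerProductSpace ℂ H]
    (s : Set (EuclideanSpace ℂ (Fin d))) : AnalyticOnNhd ℂ (rowZ H) s := by
  have hrow : rowZ H = (∑ i, (EuclideanSpace.proj i : EuclideanSpace ℂ (Fin d) →L[ℂ] ℂ).smulRight
      (PiLp.proj 2 (fun _ : Fin d => H) i) :
      EuclideanSpace ℂ (Fin d) →L[ℂ] (PiLp 2 fun _ : Fin d => H) →L[ℂ] H) := by
    ext z x
    simp [rowZ_apply, sum_apply]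
  rw [hrow]
  exact ContinuousLinearMap.analyticOnNhd _ s

namespace PureKContraction

variable {κ : KernelSeq} {d : ℕ} {H : Type*} [NormedAddCommGroup H] [InnerProductSpace ℂ H]
  [CompleteSpace H] (S : PureKContraction κ d H)

open ContinuousLinearMap (adjoint)

theorem mem_tildeD {y : PiLp 2 fun _ : Fin d => S.HTilde} :
    y ∈ S.tildeD ↔ y ∈ S.defectTilde.range.topologicalClosure ∧
      S.jTilde (S.defectTilde y) ∈ Set.range S.colMzAdj := Iff.rfl

theorem colMzAdj_rowMzDelta_colMzAdj (f : HK κ d S.defectSpace) :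
    S.colMzAdj (HK.rowMzDelta κ d S.defectSpace (S.colMzAdj f)) = S.colMzAdj f :=
  HK.adjoint_rowOp_Mz_rowMzDelta f

theorem isClosed_range_colMzAdj : IsClosed (Set.range S.colMzAdj) :=
  isClosed_range_of_apply_apply_apply_eq S.colMzAdj.continuous (HK.rowMzDelta _ _ _).continuous
    S.colMzAdj_rowMzDelta_colMzAdj

theorem isClosed_tildeD : IsClosed (S.tildeD : Set (PiLp 2 (fun _ : Fin d => S.HTilde))) :=
  (Submodule.isClosed_topologicalClosure _).inter <|
    S.isClosed_range_colMzAdj.preimage (S.jTilde ∘L S.defectTilde).continuous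

theorem rowTilde_mem_defectSpace (y : S.tildeD) : S.rowTilde y ∈ S.defectSpace := by
  have h := apply_mem_closure_range_defectOp_adjoint S.norm_rowTilde_le_one y.2.1
  rwa [S.defectOp_adjoint_rowTilde] at h

/-- The restriction of `T̃` to `𝒟̃`, with values in `𝒟`. -/
noncomputable def rowTildeD : S.tildeD →L[ℂ] S.defectSpace :=
  (S.rowTilde ∘L S.tildeD.subtypeL).codRestrict S.defectSpace S.rowTilde_mem_defectSpace

/-- The operator `W_T(z)` from `𝒟̃` to `𝒟`. -/
noncomputable def WTD (z : EuclideanSpace ℂ (Fin d)) : S.tildeD →L[ℂ] S.defectSpace :=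
  -S.rowTildeD + S.C' ∘L S.FT z ∘L rowZ H z ∘L S.invDefect ∘L S.tildeD.subtypeL

theorem coe_WTD_apply (z : EuclideanSpace ℂ (Fin d)) (y : S.tildeD) :
    (S.WTD z y : H) = S.WT z y := rfl

theorem analyticOnNhd_WTD : AnalyticOnNhd ℂ S.WTD (UBall d) :=
  analyticOnNhd_const.add <| analyticOnNhd_clm_comp analyticOnNhd_const <|
    analyticOnNhd_clm_comp S.analyticOnNhd_FT <|
      analyticOnNhd_clm_comp (analyticOnNhd_rowZ H _) analyticOnNhd_const

/-- The map `x ↦ W_T x` from `𝒟̃` to `H_K(𝒟)`; see `innerMap_apply`. -/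
noncomputable def innerMap : S.tildeD →L[ℂ] HK κ d S.defectSpace :=
  -(HK.const κ d S.defectSpace ∘L S.rowTildeD) +
    HK.rowMzDelta κ d S.defectSpace ∘L S.jTilde ∘L S.defectTilde ∘L S.tildeD.subtypeL

theorem innerMap_eq (y : S.tildeD) :
    S.innerMap y = -HK.const κ d S.defectSpace (S.rowTildeD y) +
      HK.rowMzDelta κ d S.defectSpace (S.jTilde (S.defectTilde y)) := rfl

theorem rowMzDelta_jTilde_apply (y : PiLp 2 fun _ : Fin d => S.HTilde) (z : UBall d) :
    HK.rowMzDelta κ d S.defectSpace (S.jTilde y) z =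
      S.C' (S.FT z.1 (rowZ H z.1 (oplus d (S.IT.symm : S.HTilde →L[ℂ] H) y))) := by
  simp only [HK.rowMzDelta_apply, HK.sum_apply, HK.Mz_apply, jTilde_apply, Delta_j_apply,
    rowZ_apply, oplus_apply, map_sum, map_smul]
  rfl

theorem innerMap_apply (y : S.tildeD) (z : UBall d) : S.innerMap y z = S.WTD z y := by
  rw [innerMap_eq, RKHS.coe_add, Pi.add_apply, RKHS.coe_neg, Pi.neg_apply, HK.const_apply,
    rowMzDelta_jTilde_apply]
  rfl

theorem innerMap_origin (y : S.tildeD) : S.innerMap y (HK.origin d) = -S.rowTildeD y := by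
  have hZ : rowZ H (HK.origin d).1 = 0 := by
    ext x
    simp [rowZ_apply, HK.origin]
  rw [innerMap_apply, WTD, hZ]
  simp

theorem colMzAdj_const (v : S.defectSpace) :
    S.colMzAdj (HK.const κ d S.defectSpace v) = 0 :=
  HK.adjoint_rowOp_Mz_const v

theorem colMzAdj_innerMap (y : S.tildeD) :
    S.colMzAdj (S.innerMap y) = S.jTilde (S.defectTilde y) := by
  obtain ⟨f, hf⟩ := (S.mem_tildeD.1 y.2).2
  rw [innerMap_eq, map_add, map_neg, colMzAdj_const, neg_zero, zero_add, ← hf,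
    colMzAdj_rowMzDelta_colMzAdj]

theorem jAdj_innerMap (y : S.tildeD) : S.jAdj (S.innerMap y) = 0 := by
  rw [innerMap_eq, map_add, map_neg, jAdj_const, jAdj_rowMzDelta_jTilde, rowTilde_defectTilde]
  exact neg_add_cancel _

theorem innerMap_mem_wanderingSubspace (y : S.tildeD) :
    S.innerMap y ∈ wanderingSubspace (HK.Mz κ S.defectSpace) S.M :=
  S.mem_wanderingSubspace_M_iff.2 ⟨S.jAdj_innerMap y, _, (S.colMzAdj_innerMap y).symm⟩

theorem norm_innerMap (y : S.tildeD) : ‖S.innerMap y‖ = ‖y‖ := by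
  refine (sq_eq_sq₀ (norm_nonneg _) (norm_nonneg _)).1 ?_
  calc ‖S.innerMap y‖ ^ 2
      = ‖S.rowTilde y‖ ^ 2 + ‖S.defectTilde y‖ ^ 2 := by
        rw [HK.norm_sq_eq, innerMap_origin, norm_neg]
        simp only [← colMzAdj_apply, colMzAdj_innerMap]
        rw [sum_inner_Delta_jTilde]
        rfl
    _ = ‖y‖ ^ 2 := norm_apply_sq_add_norm_defectOp_sq S.norm_rowTilde_le_one _

theorem exists_innerMap_eq {f : HK κ d S.defectSpace}
    (hf : f ∈ wanderingSubspace (HK.Mz κ S.defectSpace) S.M) : ∃ y, S.innerMap y = f := by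
  obtain ⟨hjf, x, hx⟩ := S.mem_wanderingSubspace_M_iff.1 hf
  set v : S.defectSpace := f (HK.origin d)
  have hfx : f = HK.const κ d S.defectSpace v + HK.rowMzDelta κ d S.defectSpace (S.jTilde x) := by
    rw [hx]
    exact HK.eq_const_add_rowMzDelta f
  have hTx : S.rowTilde x = S.C (-v) := by
    rw [hfx, map_add, jAdj_const, jAdj_rowMzDelta_jTilde] at hjf
    rw [map_neg, eq_neg_of_add_eq_zero_right hjf]
  rw [← S.defectOp_adjoint_rowTilde] at hTx
  obtain ⟨y, hy, hDy, hTy⟩ := exists_defectOp_eq_and_apply_eq S.norm_rowTilde_le_one hTx <| by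
    rw [S.defectOp_adjoint_rowTilde]
    exact neg_mem v.2
  change S.defectTilde y = x at hDy
  have hyD : y ∈ S.tildeD := S.mem_tildeD.2 ⟨hy, f, by rw [hDy, hx]⟩
  have hTyD : S.rowTildeD ⟨y, hyD⟩ = -v := Subtype.ext hTy
  refine ⟨⟨y, hyD⟩, ?_⟩
  rw [innerMap_eq, hTyD, hDy, map_neg, neg_neg, ← hfx]

theorem mem_wanderingSubspace_M_iff_exists_innerMap {f : HK κ d S.defectSpace} :
    f ∈ wanderingSubspace (HK.Mz κ S.defectSpace) S.M ↔ ∃ y, S.innerMap y = f :=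
  ⟨S.exists_innerMap_eq, by rintro ⟨y, rfl⟩; exact S.innerMap_mem_wanderingSubspace y⟩

theorem innerMap_eq_iff {y : S.tildeD} {f : HK κ d S.defectSpace} :
    S.innerMap y = f ↔ ∀ z : UBall d, f z = S.WTD z y := by
  refine ⟨?_, fun h => RKHS.ext fun z => ?_⟩
  · rintro rfl z
    exact S.innerMap_apply y z
  · rw [h, innerMap_apply]

theorem isKInner_WTD : IsKInner κ S.WTD :=
  ⟨S.analyticOnNhd_WTD, ⟨S.innerMap.toLinearMap, S.norm_innerMap⟩, S.innerMap_apply,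
    fun _ hα x y => inner_tuplePow_eq_zero HK.commute_Mz S.Mz_mem_M
      (S.innerMap_mem_wanderingSubspace x) (S.innerMap_mem_wanderingSubspace y).1 hα⟩

end PureKContraction

end InnerFunction

theorem mainTheorem4 (κ : KernelSeq) {d : ℕ} {H : Type*} [NormedAddCommGroup H]
    [InnerProductSpace ℂ H] [CompleteSpace H] (S : PureKContraction κ d H) :
    -- the canonical dilation intertwines, so that `M` is invariant under `M_z`
    (∀ i h, S.j (ContinuousLinearMap.adjoint (S.T i) h) =
      ContinuousLinearMap.adjoint (HK.Mz κ S.defectSpace i) (S.j h)) ∧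
    -- `𝒟̃` is a closed subspace of `H̃^d`
    IsClosed (S.tildeD : Set (PiLp 2 (fun _ : Fin d => S.HTilde))) ∧
    -- the series `F(Z T^*)` converges for `z` in the ball
    (∀ z ∈ UBall d, Summable fun n => (κ.a (n + 1) : ℂ) • S.ZTadj z ^ n) ∧
    ∃ W : EuclideanSpace ℂ (Fin d) → S.tildeD →L[ℂ] S.defectSpace,
      (∀ z ∈ UBall d, ∀ x : S.tildeD, (W z x : H) = S.WT z x) ∧
      -- each `W_T x` belongs to `H_K(𝒟)` and `‖W_T x‖ = ‖x‖`
      (∀ x : S.tildeD, ∃ f : HK κ d S.defectSpace, (∀ z : UBall d, f z = W z x) ∧ ‖f‖ = ‖x‖) ∧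
      -- `W(M) = {W_T x ; x ∈ 𝒟̃}`
      (∀ f : HK κ d S.defectSpace, f ∈ wanderingSubspace (HK.Mz κ S.defectSpace) S.M ↔
        ∃ x : S.tildeD, ∀ z : UBall d, f z = W z x) ∧
      IsKInner κ W := by
  refine ⟨fun i h => ?_, S.isClosed_tildeD, fun z hz => S.summable_FT hz, S.WTD,
    fun z _ x => S.coe_WTD_apply z x,
    fun x => ⟨S.innerMap x, S.innerMap_apply x, S.norm_innerMap x⟩, fun f => ?_, S.isKInner_WTD⟩
  · rw [HK.adjoint_Mz, S.j_adjoint]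
  · simp only [S.mem_wanderingSubspace_M_iff_exists_innerMap, S.innerMap_eq_iff]
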